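/- Let $A\in\mathbb Z^{(1+n)\times N}$ be an integer matrix of full rank $1+n$ whose top row is $(1,\dots,1)$, with columns $\alpha_1,\dots,\alpha_N$ (an algebraic point configuration; repeated columns are allowed), and let $\hat A$ be $A$ with its top row deleted. The discriminant variety $\check X_A\subset(\mathbb C^\times)^N$ is the Zariski closure in $(\mathbb C^\times)^N$ of the set of $c\in(\mathbb C^\times)^N$ for which the exponential sum $f(w)=\sum_k c_k e^{\langle w,\alpha_k\rangle}$, $w\in\mathbb C^{1+n}$, has a singular point, i.e. a point where $f=0$ and $df=0$. Let $B\in\mathbb C^{N\times m}$, with rows $\beta_1,\dots,\beta_N$, be a Gale dual of $A$, i.e. $0\to\mathbb C^m\xrightarrow{B}\mathbb C^N\xrightarrow{A}\mathbb C^{1+n}\to 0$ is exact. Put $\mathbb C^m_B=\{t\in\mathbb C^m: Bt\in(\mathbb C^\times)^N\}$ and let $$\Phi(\omega;t)=\big(e^{\langle\omega,\alpha_k\rangle}\,\langle\beta_k,t\rangle\big)_{k=1}^N,\qquad \omega\in\mathbb C^{1+n},\ t\in\mathbb C^m_B,$$ be the Horn--Kapranov map. The cuspidal locus of $\check X_A$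 is the Zariski closure in $(\mathbb C^\times)^N$ of the set of points $\Phi(\omega;t)$ for which the image of $d\Phi_{(\omega;t)}$ has dimension at most $N-2$. The cuspidal form of $A$ is $$P_A(t)=\sum_{\sigma\subset\{1,\dots,N\},\ |\sigma|=n}|\hat A_\sigma|^2\prod_{k\in\sigma}\langle\beta_k,t\rangle ,$$ where $|\hat A_\sigma|$ is the maximal minor of $\hat A$ with columns in $\sigma$. Theorem. Let $0\ne\ell\in\mathbb C^m$ be such that the linear form $\langle\ell,t\rangle$ divides $P_A(t)$ and such that no row $\beta_k$ of $B$ is a scalar multiple of $\ell$. Let $Y_\ell\subset(\mathbb C^\times)^N$ be the Zariski closure of $\{\Phi(\omega;t):\omega\in\mathbb C^{1+n},\ t\in\mathbb C^m_B,\ \langle\ell,t\rangle=0\}$. Then $Y_\ell$ is an irreducible closed subvariety of $(\mathbb C^\times)^N$ contained in the cuspidal locus of $\check X_A$, and there is an algebraic point configuration $E$ (an integer matrix of full row rank with top row $(1,\dots,1)$, of any size) such that $\check X_E$ is irreducible and birational to $Y_\ell$. -/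

import Mathlib

open MvPolynomial

noncomputable section

namespace Cuspidal

/-! ### Subvarieties of the algebraic torus and birational equivalence -/

/-- The algebraic torus `(ℂ^×)^N`, as a subset of `ℂ^N`. -/
def torus (N : ℕ) : Set (Fin N → ℂ) := {c | ∀ k, c k ≠ 0}

/-- The Zariski closure of `S` inside the torus `(ℂ^×)^N`. -/
def torusClosure {N : ℕ} (S : Set (Fin N → ℂ)) : Set (Fin N → ℂ) :=
  torus N ∩ zeroLocus ℂ (vanishingIdeal ℂ S)

/-- `V` is an irreducible (in particular nonempty) Zariski closed subset of `(ℂ^×)^N`. -/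
structure IsTorusSubvariety {N : ℕ} (V : Set (Fin N → ℂ)) : Prop where
  closed : torusClosure V = V
  irreducible : (vanishingIdeal ℂ V : Ideal (MvPolynomial (Fin N) ℂ)).IsPrime

/-- The rational map `x ↦ (p₁(x)/d(x), …, p_M(x)/d(x))`. -/
def ratMap {N M : ℕ} (p : Fin M → MvPolynomial (Fin N) ℂ) (d : MvPolynomial (Fin N) ℂ)
    (x : Fin N → ℂ) : Fin M → ℂ :=
  fun j => eval x (p j) / eval x d

/-- Birational equivalence of irreducible varieties `V`, `W`: there are mutually inverse
rational maps between nonempty Zariski open subsets `{x ∈ V | d(x) ≠ 0}` and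
`{y ∈ W | e(y) ≠ 0}`. -/
def AreBirational {N M : ℕ} (V : Set (Fin N → ℂ)) (W : Set (Fin M → ℂ)) : Prop :=
  ∃ (p : Fin M → MvPolynomial (Fin N) ℂ) (d : MvPolynomial (Fin N) ℂ)
    (q : Fin N → MvPolynomial (Fin M) ℂ) (e : MvPolynomial (Fin M) ℂ),
    (∃ x ∈ V, eval x d ≠ 0) ∧ (∃ y ∈ W, eval y e ≠ 0) ∧
    (∀ x ∈ V, eval x d ≠ 0 →
      ratMap p d x ∈ W ∧ eval (ratMap p d x) e ≠ 0 ∧ ratMap q e (ratMap p d x) = x) ∧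
    (∀ y ∈ W, eval y e ≠ 0 →
      ratMap q e y ∈ V ∧ eval (ratMap q e y) d ≠ 0 ∧ ratMap p d (ratMap q e y) = y)

/-! ### Configurations, exponential sums and discriminants -/

/-- An algebraic point configuration, given by the `(1+n) × N` integer matrix whose columns
are its points (repetitions allowed): the top row is the all ones vector, and the matrix
has full rank `1 + n`. -/
structure IsAlgConfig {n N : ℕ} (A : Matrix (Fin (n + 1)) (Fin N) ℤ) : Prop where
  top_row : ∀ k, A 0 k = 1
  full_rank : (A.map (Int.cast : ℤ → ℂ)).rank = n + 1

/-- The map `exp_A : ω ↦ (e^⟨ω, α₁⟩, …, e^⟨ω, α_N⟩)`. -/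
def expA {n N : ℕ} (A : Matrix (Fin (n + 1)) (Fin N) ℤ) (ω : Fin (n + 1) → ℂ) :
    Fin N → ℂ :=
  fun k => Complex.exp (∑ i, ω i * (A i k : ℂ))

/-- The exponential sum `f(w) = ∑ₖ cₖ e^⟨w, αₖ⟩`. -/
def expSum {n N : ℕ} (A : Matrix (Fin (n + 1)) (Fin N) ℤ) (c : Fin N → ℂ)
    (w : Fin (n + 1) → ℂ) : ℂ :=
  ∑ k, c k * expA A w k

/-- `w` is a singular point of the zero locus of the exponential sum with coefficients `c`. -/
def IsSingularPoint {n N : ℕ} (A : Matrix (Fin (n + 1)) (Fin N) ℤ) (c : Fin N → ℂ)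
    (w : Fin (n + 1) → ℂ) : Prop :=
  expSum A c w = 0 ∧ fderiv ℂ (expSum A c) w = 0

/-- The `A`-discriminantal variety: the Zariski closure in `(ℂ^×)^N` of the set of (coefficient
vectors of) exponential sums that have a singular point. -/
def discriminant {n N : ℕ} (A : Matrix (Fin (n + 1)) (Fin N) ℤ) : Set (Fin N → ℂ) :=
  torusClosure {c | c ∈ torus N ∧ ∃ w, IsSingularPoint A c w}

/-! ### Gale duals and the cuspidal form -/

/-- `B` is a Gale dual of `A`: `0 → ℂ^m → ℂ^N → ℂ^{1+n}` is exact, with maps `B` and `A`. -/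
structure IsGaleDual {n N m : ℕ} (A : Matrix (Fin (n + 1)) (Fin N) ℤ)
    (B : Matrix (Fin N) (Fin m) ℂ) : Prop where
  injective : Function.Injective B.mulVec
  exact : ∀ c : Fin N → ℂ, (A.map (Int.cast : ℤ → ℂ)).mulVec c = 0 ↔ ∃ t, B.mulVec t = c

/-- The linear form `⟨ℓ, t⟩` as a polynomial in the variables `t`. -/
def linForm {m : ℕ} (l : Fin m → ℂ) : MvPolynomial (Fin m) ℂ := ∑ i, C (l i) * X i

/-- The minor `|Â_σ|`: delete the top row and keep the columns in `σ`, in increasing order. -/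
def hatMinor {n N : ℕ} (A : Matrix (Fin (n + 1)) (Fin N) ℤ)
    (σ : {σ : Finset (Fin N) // σ.card = n}) : ℤ :=
  (Matrix.of fun i j : Fin n => A i.succ (σ.1.orderEmbOfFin σ.2 j)).det

/-- The cuspidal form `P_A(t) = ∑_σ |Â_σ|² ∏_{k ∈ σ} ⟨β_k, t⟩`, the sum over all sets `σ` of
`n` column indices, where `β_k` is the `k`-th row of `B`. -/
def cuspidalForm {n N m : ℕ} (A : Matrix (Fin (n + 1)) (Fin N) ℤ)
    (B : Matrix (Fin N) (Fin m) ℂ) : MvPolynomial (Fin m) ℂ :=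
  ∑ σ : {σ : Finset (Fin N) // σ.card = n},
    C ((hatMinor A σ : ℂ) ^ 2) * ∏ k ∈ σ.1, linForm (B k)

/-! ### The Horn–Kapranov uniformization and the cuspidal locus -/

/-- The Horn–Kapranov map `Φ(ω; t) = exp_A(ω) * (B t)`, with componentwise product. -/
def hornKapranov {n N m : ℕ} (A : Matrix (Fin (n + 1)) (Fin N) ℤ)
    (B : Matrix (Fin N) (Fin m) ℂ) (x : (Fin (n + 1) → ℂ) × (Fin m → ℂ)) : Fin N → ℂ :=
  fun k => expA A x.1 k * B.mulVec x.2 k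

/-- `ℂ^m_B`, the preimage of the torus under `B`. -/
def galeDomain {N m : ℕ} (B : Matrix (Fin N) (Fin m) ℂ) : Set (Fin m → ℂ) :=
  {t | B.mulVec t ∈ torus N}

/-- The cuspidal locus: the Zariski closure in `(ℂ^×)^N` of the set of cusps, that is, of the
points `Φ(ω; t)` at which the image of the differential of `Φ` has dimension at most `N - 2`.
(The direction `ω₀` and the radial direction in `t` have the same image under `dΦ`, so setting
`ω₀ = 0` does not change this rank.) -/
def cuspidalLocus {n N m : ℕ} (A : Matrix (Fin (n + 1)) (Fin N) ℤ)
    (B : Matrix (Fin N) (Fin m) ℂ) : Set (Fin N → ℂ) :=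
  torusClosure {f | ∃ (ω : Fin (n + 1) → ℂ) (t : Fin m → ℂ), t ∈ galeDomain B ∧
    Module.finrank ℂ (LinearMap.range (fderiv ℂ (hornKapranov A B) (ω, t)).toLinearMap) + 2 ≤ N ∧
    f = hornKapranov A B (ω, t)}

/-- The part of the discriminant lying over the hyperplane `ℓ^* = {t | ⟨ℓ, t⟩ = 0}`: the Zariski
closure in `(ℂ^×)^N` of the image under `Φ` of `ℂ^{1+n} × (ℓ^* ∩ ℂ^m_B)`. -/
def hyperplaneImage {n N m : ℕ} (A : Matrix (Fin (n + 1)) (Fin N) ℤ)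
    (B : Matrix (Fin N) (Fin m) ℂ) (l : Fin m → ℂ) : Set (Fin N → ℂ) :=
  torusClosure {f | ∃ (ω : Fin (n + 1) → ℂ) (t : Fin m → ℂ), t ∈ galeDomain B ∧
    ∑ i, l i * t i = 0 ∧ f = hornKapranov A B (ω, t)}

end Cuspidal

end

/-! Write `L` for the image under `B` of the hyperplane orthogonal to `ℓ`. Then `Y_ℓ` is the closure
of the points `x = c s^A`, with `s` in a torus and `c` in `L`. The inclusion in the cuspidal locus
is linear algebra: by Cauchy–Binet `P_A(t)` is the determinant of `Â diag(Bt) Âᵀ`, and a kernel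
vector of that matrix yields a second covector killing the image of `dΦ`, besides the one coming
from homogeneity (`finrank_range_fderiv_le`).

For the birational statement it suffices that the function field `K` of `Y_ℓ` is purely
transcendental over `ℂ` of some degree `d + 1 ≥ 1`. The discriminant of a simplex with vertices `e₁,
…, e_d, -e₁ - ⋯ - e_d` and an interior point is a graph over `d + 1` free coefficients, so it has
the same function field (`exists_generic_discriminant_starConfig`). Irreducible subvarieties are
handled through generic points, and equal function fields give birational varieties
(`areBirational_genericLocus`).

Rationality (`exists_purely_transcendental`) rests on the conormal space. Let `F ⊇ K` be the field
of rational functions in the parameters, `P` and `Q` the scalar extensions to `F` of `orth L` and of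
the row span of `A`, of dimensions `r + 1` and `r`. In logarithmic coordinates the conormal space at
`x` is `c·U`, where `U` is the part of `P` orthogonal to `Q` for the form `∑ cₖuₖvₖ`. Let `W` be the
radical of the form on `P`, and `V` the part of `Q` orthogonal to `P`. Then `V ⊆ W ⊆ U` and `dim U =
dim V + 1`, so either `W = V` or `W = U`. Put `R = rowSpan A` in the first case and `R = orth L` in
the second. In both cases `W` lies in the scalar extension `R_F` of `R`, and the scalings with
exponents in `R` are tangent to `Y_ℓ`.

For `g` in `W`, the vector field `c ↦ cg` is an `F`-combination of these scalings. It therefore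
preserves the conormal space, and this forces `Du + gu ∈ W` for `u ∈ W`. Inductively all powers of
elements of `W` lie in `R_F` (`pow_le_scalarExt`). Interpolation then puts the indicators of level
sets of `u` in `R`, so a nowhere vanishing `u` satisfies every integer monomial relation orthogonal
to `R`.

Since `c·W` comes from a subspace defined over `K`, it contains a vector `c'` over `K` without zero
entries, generated over `ℂ` by `dim L - dim W` elements. The quotient `x / c'` lies on the torus
with exponents `R`, so it needs at most `dim R` monomials. In both cases this gives at most `N - dim
U` generators of `K`, which is the dimension of its space of derivations. Hence they are
algebraically independent. -/

namespace Cuspidal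

/-! ### Generic points of subvarieties of the torus -/

/-- The closed subvariety of the torus with generic point `ξ`. -/
def genericLocus {N : ℕ} {F : Type} [Field F] [Algebra ℂ F] (ξ : Fin N → F) :
    Set (Fin N → ℂ) :=
  torus N ∩ zeroLocus ℂ (RingHom.ker (aeval ξ : MvPolynomial (Fin N) ℂ →ₐ[ℂ] F))

section Generic

variable {F : Type} [Field F] [Algebra ℂ F]

/-- By the Nullstellensatz for a prime ideal. Restricting to the torus loses nothing: if `p`
vanishes on the torus points, `p` times the product of the coordinates vanishes on the whole zero
locus, and no coordinate of `ξ` is zero. -/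
theorem vanishingIdeal_genericLocus {N : ℕ} {ξ : Fin N → F} (hξ : ∀ k, ξ k ≠ 0) :
    vanishingIdeal ℂ (genericLocus ξ) =
      RingHom.ker (aeval ξ : MvPolynomial (Fin N) ℂ →ₐ[ℂ] F) := by
  apply le_antisymm
  · intro p hp
    have hprime : (RingHom.ker (aeval ξ : MvPolynomial (Fin N) ℂ →ₐ[ℂ] F)).IsPrime :=
      RingHom.ker_isPrime _
    have h : p * ∏ k, X k ∈ RingHom.ker (aeval ξ : MvPolynomial (Fin N) ℂ →ₐ[ℂ] F) := by
      rw [← IsPrime.vanishingIdeal_zeroLocus (K := ℂ)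
        (RingHom.ker (aeval ξ : MvPolynomial (Fin N) ℂ →ₐ[ℂ] F))]
      intro x hx
      by_cases hxt : x ∈ torus N
      · rw [map_mul, hp x ⟨hxt, hx⟩, zero_mul]
      · simp only [torus, Set.mem_ofPred_eq, not_forall, not_not] at hxt
        obtain ⟨k, hk⟩ := hxt
        rw [map_mul, map_prod, Finset.prod_eq_zero (Finset.mem_univ k) (by simpa using hk),
          mul_zero]
    rw [RingHom.mem_ker, map_mul, map_prod] at h
    rcases mul_eq_zero.1 h with h | h
    · exact h
    · obtain ⟨k, -, hk⟩ := Finset.prod_eq_zero_iff.1 h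
      exact absurd (by simpa using hk) (hξ k)
  · intro p hp x hx
    exact hx.2 p hp

theorem isTorusSubvariety_genericLocus {N : ℕ} {ξ : Fin N → F} (hξ : ∀ k, ξ k ≠ 0) :
    IsTorusSubvariety (genericLocus ξ) where
  closed := by
    rw [torusClosure, vanishingIdeal_genericLocus hξ, genericLocus]
  irreducible := by
    rw [vanishingIdeal_genericLocus hξ]
    exact RingHom.ker_isPrime _

theorem torusClosure_eq_genericLocus {N : ℕ} {ξ : Fin N → F} {S : Set (Fin N → ℂ)}
    (h : vanishingIdeal ℂ S = RingHom.ker (aeval ξ : MvPolynomial (Fin N) ℂ →ₐ[ℂ] F)) :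
    torusClosure S = genericLocus ξ := by
  rw [torusClosure, h, genericLocus]

theorem exists_mem_genericLocus_eval_ne_zero {N : ℕ} {ξ : Fin N → F} (hξ : ∀ k, ξ k ≠ 0)
    {d : MvPolynomial (Fin N) ℂ} (hd : aeval ξ d ≠ 0) :
    ∃ x ∈ genericLocus ξ, eval x d ≠ 0 := by
  by_contra! h
  apply hd
  have : d ∈ vanishingIdeal ℂ (genericLocus ξ) := fun x hx => h x hx
  rwa [vanishingIdeal_genericLocus hξ] at this

end Generic

/-! ### Substituting quotients into polynomials -/

/-- The numerator `G` and exponent `k` do not depend on the field or the point. This uniformity is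
what carries identities from the generic point over `F` to closed points over `ℂ`. -/
theorem exists_clear_denominators {ι κ : Type} (p : κ → MvPolynomial ι ℂ) (d : MvPolynomial ι ℂ)
    (g : MvPolynomial κ ℂ) :
    ∃ (G : MvPolynomial ι ℂ) (k : ℕ), ∀ (F : Type) [Field F] [Algebra ℂ F] (x : ι → F),
      aeval x d ≠ 0 →
        aeval (fun j => aeval x (p j) / aeval x d) g * aeval x d ^ k = aeval x G := by
  induction g using MvPolynomial.induction_on with
  | C a => exact ⟨C a, 0, fun F _ _ x hx => by simp⟩
  | add g₁ g₂ h₁ h₂ =>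
    obtain ⟨G₁, k₁, h₁⟩ := h₁
    obtain ⟨G₂, k₂, h₂⟩ := h₂
    refine ⟨G₁ * d ^ k₂ + G₂ * d ^ k₁, k₁ + k₂, fun F _ _ x hx => ?_⟩
    simp only [map_add, map_mul, map_pow, ← h₁ F x hx, ← h₂ F x hx]
    ring
  | mul_X g j h =>
    obtain ⟨G, k, h⟩ := h
    refine ⟨G * p j, k + 1, fun F _ _ x hx => ?_⟩
    simp only [map_mul, aeval_X, ← h F x hx]
    field_simp
    ring

theorem exists_common_denominator {N M : ℕ} {F : Type} [Field F] [Algebra ℂ F] {ξ : Fin N → F}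
    {η : Fin M → F} (h : ∀ j, η j ∈ IntermediateField.adjoin ℂ (Set.range ξ)) :
    ∃ (p : Fin M → MvPolynomial (Fin N) ℂ) (d : MvPolynomial (Fin N) ℂ), aeval ξ d ≠ 0 ∧
      ∀ j, η j = aeval ξ (p j) / aeval ξ d := by
  have h' : ∀ j, ∃ r s : MvPolynomial (Fin N) ℂ, aeval ξ s ≠ 0 ∧ η j = aeval ξ r / aeval ξ s := by
    intro j
    obtain ⟨r, s, hrs⟩ := (IntermediateField.mem_adjoin_range_iff ℂ ξ (η j)).1 (h j)
    by_cases hs : aeval ξ s = 0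
    · exact ⟨0, 1, by simp, by rw [hrs, hs]; simp⟩
    · exact ⟨r, s, hs, hrs⟩
  choose r s hs hr using h'
  refine ⟨fun j => r j * ∏ i ∈ Finset.univ.erase j, s i, ∏ i, s i, ?_, fun j => ?_⟩
  · rw [map_prod]
    exact Finset.prod_ne_zero_iff.2 fun i _ => hs i
  · rw [← Finset.mul_prod_erase Finset.univ s (Finset.mem_univ j), map_mul, map_mul, hr j,
      mul_div_mul_right]
    rw [map_prod]
    exact Finset.prod_ne_zero_iff.2 fun i _ => hs i

/-! ### Birational equivalence from an equality of function fields -/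

section Birational

variable {F : Type} [Field F] [Algebra ℂ F] {N M : ℕ} {ξ : Fin N → F} {η : Fin M → F}

theorem eval_eq_zero_of_mem_genericLocus {x : Fin N → ℂ} (hx : x ∈ genericLocus ξ)
    {g : MvPolynomial (Fin N) ℂ} (hg : aeval ξ g = 0) : eval x g = 0 :=
  hx.2 g hg

/-- Membership and inversion are polynomial identities at `ξ` after clearing denominators, so they
hold at every point of the locus where the denominators do not vanish. -/
theorem ratMap_mem_genericLocus {p : Fin M → MvPolynomial (Fin N) ℂ}
    {d : MvPolynomial (Fin N) ℂ} {q : Fin N → MvPolynomial (Fin M) ℂ}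
    {e : MvPolynomial (Fin M) ℂ} (hd : aeval ξ d ≠ 0)
    (hp : ∀ j, η j = aeval ξ (p j) / aeval ξ d) (he : aeval η e ≠ 0)
    (hq : ∀ i, ξ i = aeval η (q i) / aeval η e) {x : Fin N → ℂ} (hx : x ∈ genericLocus ξ)
    (hdx : eval x d ≠ 0) (hpx : ∀ j, eval x (p j) ≠ 0) (hex : eval (ratMap p d x) e ≠ 0) :
    ratMap p d x ∈ genericLocus η ∧ ratMap q e (ratMap p d x) = x := by
  have hη : (fun j => aeval ξ (p j) / aeval ξ d) = η := funext fun j => (hp j).symm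
  have key : ∀ g : MvPolynomial (Fin M) ℂ, aeval η g = 0 → eval (ratMap p d x) g = 0 := by
    intro g hg
    obtain ⟨G, k, hG⟩ := exists_clear_denominators p d g
    have h₁ := hG F ξ hd
    have h₂ := hG ℂ x hdx
    rw [hη, hg, zero_mul] at h₁
    have h₃ : eval x G = 0 := eval_eq_zero_of_mem_genericLocus hx h₁.symm
    change eval (ratMap p d x) g * eval x d ^ k = eval x G at h₂
    rw [h₃] at h₂
    exact (mul_eq_zero.1 h₂).resolve_right (pow_ne_zero _ hdx)
  refine ⟨⟨fun j => div_ne_zero (hpx j) hdx, fun g hg => key g hg⟩, ?_⟩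
  funext i
  rw [ratMap, div_eq_iff hex]
  obtain ⟨G₁, k₁, h₁⟩ := exists_clear_denominators p d (q i)
  obtain ⟨G₂, k₂, h₂⟩ := exists_clear_denominators p d e
  have e₁ := h₁ F ξ hd
  have e₂ := h₂ F ξ hd
  have f₁ : eval (ratMap p d x) (q i) * eval x d ^ k₁ = eval x G₁ := h₁ ℂ x hdx
  have f₂ : eval (ratMap p d x) e * eval x d ^ k₂ = eval x G₂ := h₂ ℂ x hdx
  rw [hη] at e₁ e₂
  have hz : aeval ξ (G₁ * d ^ k₂ - X i * (G₂ * d ^ k₁)) = 0 := by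
    have := (eq_div_iff he).1 (hq i)
    simp only [map_sub, map_mul, map_pow, aeval_X, ← e₁, ← e₂, ← this]
    ring
  have hz' := eval_eq_zero_of_mem_genericLocus hx hz
  simp only [map_sub, map_mul, map_pow, eval_X, ← f₁, ← f₂] at hz'
  have hne : eval x d ^ k₁ * eval x d ^ k₂ ≠ 0 := mul_ne_zero (pow_ne_zero _ hdx) (pow_ne_zero _ hdx)
  apply mul_right_cancel₀ hne
  linear_combination hz'

theorem areBirational_genericLocus (hξ : ∀ k, ξ k ≠ 0) (hη : ∀ k, η k ≠ 0)
    (h₁ : ∀ j, η j ∈ IntermediateField.adjoin ℂ (Set.range ξ))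
    (h₂ : ∀ i, ξ i ∈ IntermediateField.adjoin ℂ (Set.range η)) :
    AreBirational (genericLocus ξ) (genericLocus η) := by
  obtain ⟨p, d, hd, hp⟩ := exists_common_denominator h₁
  obtain ⟨q, e, he, hq⟩ := exists_common_denominator h₂
  have hη' : (fun j => aeval ξ (p j) / aeval ξ d) = η := funext fun j => (hp j).symm
  have hξ' : (fun j => aeval η (q j) / aeval η e) = ξ := funext fun j => (hq j).symm
  have hpne : ∀ j, aeval ξ (p j) ≠ 0 := fun j h => hη j (by rw [hp j, h, zero_div])
  have hqne : ∀ j, aeval η (q j) ≠ 0 := fun j h => hξ j (by rw [hq j, h, zero_div])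
  -- `E ≠ 0` at `x` means that at the image of `x` the inverse map is defined and lands in the
  -- torus; `D` plays the same role in the other direction.
  obtain ⟨E, k, hE⟩ := exists_clear_denominators p d (e * ∏ i, q i)
  obtain ⟨D, l, hD⟩ := exists_clear_denominators q e (d * ∏ i, p i)
  have hEξ : aeval ξ E ≠ 0 := by
    rw [← hE F ξ hd, hη', map_mul, map_prod]
    exact mul_ne_zero (mul_ne_zero he (Finset.prod_ne_zero_iff.2 fun i _ => hqne i))
      (pow_ne_zero _ hd)
  have hDη : aeval η D ≠ 0 := by
    rw [← hD F η he, hξ', map_mul, map_prod]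
    exact mul_ne_zero (mul_ne_zero hd (Finset.prod_ne_zero_iff.2 fun i _ => hpne i))
      (pow_ne_zero _ he)
  have hP : ∀ x, eval x (∏ i, p i) * eval x E ≠ 0 →
      ratMap (fun j => p j * ((∏ i, p i) * E)) (d * ((∏ i, p i) * E)) x = ratMap p d x := by
    intro x hx
    funext j
    rw [ratMap, ratMap, map_mul, map_mul _ _ (_ * _), mul_div_mul_right]
    rwa [map_mul]
  have hQ : ∀ x, eval x (∏ i, q i) * eval x D ≠ 0 →
      ratMap (fun j => q j * ((∏ i, q i) * D)) (e * ((∏ i, q i) * D)) x = ratMap q e x := by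
    intro x hx
    funext j
    rw [ratMap, ratMap, map_mul, map_mul _ _ (_ * _), mul_div_mul_right]
    rwa [map_mul]
  -- Expanding each fraction by a common factor leaves the map unchanged but shrinks its domain, so
  -- that the two open sets correspond exactly.
  refine ⟨fun j => p j * ((∏ i, p i) * E), d * ((∏ i, p i) * E),
    fun j => q j * ((∏ i, q i) * D), e * ((∏ i, q i) * D),
    exists_mem_genericLocus_eval_ne_zero hξ ?_, exists_mem_genericLocus_eval_ne_zero hη ?_, ?_, ?_⟩
  · rw [map_mul, map_mul, map_prod]
    exact mul_ne_zero hd (mul_ne_zero (Finset.prod_ne_zero_iff.2 fun i _ => hpne i) hEξ)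
  · rw [map_mul, map_mul, map_prod]
    exact mul_ne_zero he (mul_ne_zero (Finset.prod_ne_zero_iff.2 fun i _ => hqne i) hDη)
  · intro x hx hdx
    rw [map_mul, map_mul] at hdx
    have hdx0 := left_ne_zero_of_mul hdx
    rw [hP x (right_ne_zero_of_mul hdx)]
    have hEx := right_ne_zero_of_mul (right_ne_zero_of_mul hdx)
    have hpx := left_ne_zero_of_mul (right_ne_zero_of_mul hdx)
    have hE' : eval (ratMap p d x) (e * ∏ i, q i) * eval x d ^ k = eval x E := hE ℂ x hdx0
    rw [← hE', map_mul] at hEx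
    have hex := left_ne_zero_of_mul (left_ne_zero_of_mul hEx)
    have hqx := right_ne_zero_of_mul (left_ne_zero_of_mul hEx)
    have hpx' := hpx
    rw [map_prod, Finset.prod_ne_zero_iff] at hpx'
    obtain ⟨hW, hinv⟩ := ratMap_mem_genericLocus hd hp he hq hx hdx0
      (fun j => hpx' j (Finset.mem_univ j)) hex
    have hDy : eval (ratMap p d x) D ≠ 0 := by
      have : eval (ratMap q e (ratMap p d x)) (d * ∏ i, p i) * eval (ratMap p d x) e ^ l =
        eval (ratMap p d x) D := hD ℂ _ hex
      rw [← this, hinv, map_mul]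
      exact mul_ne_zero (mul_ne_zero hdx0 hpx) (pow_ne_zero _ hex)
    refine ⟨hW, ?_, ?_⟩
    · rw [map_mul, map_mul]
      exact mul_ne_zero hex (mul_ne_zero hqx hDy)
    · rw [hQ _ (mul_ne_zero hqx hDy), hinv]
  · intro x hx hdx
    rw [map_mul, map_mul] at hdx
    have hdx0 := left_ne_zero_of_mul hdx
    rw [hQ x (right_ne_zero_of_mul hdx)]
    have hEx := right_ne_zero_of_mul (right_ne_zero_of_mul hdx)
    have hpx := left_ne_zero_of_mul (right_ne_zero_of_mul hdx)
    have hE' : eval (ratMap q e x) (d * ∏ i, p i) * eval x e ^ l = eval x D := hD ℂ x hdx0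
    rw [← hE', map_mul] at hEx
    have hex := left_ne_zero_of_mul (left_ne_zero_of_mul hEx)
    have hqx := right_ne_zero_of_mul (left_ne_zero_of_mul hEx)
    have hpx' := hpx
    rw [map_prod, Finset.prod_ne_zero_iff] at hpx'
    obtain ⟨hW, hinv⟩ := ratMap_mem_genericLocus he hq hd hp hx hdx0
      (fun j => hpx' j (Finset.mem_univ j)) hex
    have hDy : eval (ratMap q e x) E ≠ 0 := by
      have : eval (ratMap p d (ratMap q e x)) (e * ∏ i, q i) * eval (ratMap q e x) d ^ k =
        eval (ratMap q e x) E := hE ℂ _ hex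
      rw [← this, hinv, map_mul]
      exact mul_ne_zero (mul_ne_zero hdx0 hpx) (pow_ne_zero _ hex)
    refine ⟨hW, ?_, ?_⟩
    · rw [map_mul, map_mul]
      exact mul_ne_zero hex (mul_ne_zero hqx hDy)
    · rw [hP _ (mul_ne_zero hqx hDy), hinv]

end Birational

/-- The vanishing ideal of a set parametrized by rational functions. -/
theorem vanishingIdeal_of_parametrization {F : Type} [Field F] [Algebra ℂ F] {N : ℕ} {ι : Type}
    {y : ι → F} (hy : AlgebraicIndependent ℂ y) {a : Fin N → MvPolynomial ι ℂ}
    {b h : MvPolynomial ι ℂ} (hb : b ≠ 0) (hh : h ≠ 0) {η : Fin N → F}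
    (hη : ∀ k, η k = aeval y (a k) / aeval y b) {S : Set (Fin N → ℂ)}
    (hS : ∀ c, c ∈ S ↔ ∃ τ, eval τ b ≠ 0 ∧ eval τ h ≠ 0 ∧ ∀ k, c k = eval τ (a k) / eval τ b) :
    vanishingIdeal ℂ S = RingHom.ker (aeval η : MvPolynomial (Fin N) ℂ →ₐ[ℂ] F) := by
  have hby : aeval y b ≠ 0 := fun h0 => hb ((injective_iff_map_eq_zero _).1 hy b h0)
  have hη' : (fun k => aeval y (a k) / aeval y b) = η := funext fun k => (hη k).symm
  ext p
  obtain ⟨P, k, hP⟩ := exists_clear_denominators a b p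
  have hPy := hP F y hby
  rw [hη'] at hPy
  rw [RingHom.mem_ker]
  constructor
  · intro hp
    -- The cleared numerator vanishes on the dense open set `b h ≠ 0`, so its product with `b h`
    -- vanishes everywhere.
    have hz : P * (b * h) = 0 := by
      apply MvPolynomial.funext
      intro τ
      rw [map_mul, map_mul, map_zero]
      by_cases hτ : eval τ b ≠ 0 ∧ eval τ h ≠ 0
      · have h1 : aeval (fun j => eval τ (a j) / eval τ b) p * eval τ b ^ k = eval τ P :=
          hP ℂ τ hτ.1
        rw [← h1, hp _ ((hS _).2 ⟨τ, hτ.1, hτ.2, fun k => rfl⟩)]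
        ring
      · rw [not_and_or, not_not, not_not] at hτ
        rcases hτ with h0 | h0 <;> rw [h0] <;> ring
    have hP0 : P = 0 := (mul_eq_zero.1 hz).resolve_right (mul_ne_zero hb hh)
    rw [hP0, map_zero] at hPy
    exact (mul_eq_zero.1 hPy).resolve_right (pow_ne_zero _ hby)
  · intro hp c hc
    obtain ⟨τ, h1, h2, h3⟩ := (hS c).1 hc
    have hcc : c = fun j => eval τ (a j) / eval τ b := funext h3
    have hP1 : aeval (fun j => eval τ (a j) / eval τ b) p * eval τ b ^ k = eval τ P := hP ℂ τ h1
    change aeval η p = 0 at hp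
    rw [hp, zero_mul] at hPy
    rw [(injective_iff_map_eq_zero _).1 hy P hPy.symm, map_zero, ← hcc] at hP1
    exact (mul_eq_zero.1 hP1).resolve_right (pow_ne_zero _ h1)

end Cuspidal

namespace Cuspidal

/-! ### Extending derivations -/

/-- The kernel is the image of the first cotangent homology of `B` over `A`, which is zero by formal
smoothness. -/
theorem mapBaseChange_injective {R A B : Type} [CommRing R] [CommRing A] [CommRing B]
    [Algebra R A] [Algebra A B] [Algebra R B] [IsScalarTower R A B] [Algebra.FormallySmooth A B] :
    Function.Injective (KaehlerDifferential.mapBaseChange R A B) := by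
  rw [injective_iff_map_eq_zero]
  intro a ha
  obtain ⟨z, hz⟩ := (Algebra.H1Cotangent.exact_δ_mapBaseChange R A B a).1 ha
  rw [← hz, Subsingleton.elim z 0, map_zero]

/-- Derivations are linear maps on differentials; over the field `B` the injection `B ⊗ Ω_A → Ω_B`
splits, so such a map extends along it. -/
theorem exists_derivation_extension {R A B : Type} [CommRing R] [CommRing A] [Field B]
    [Algebra R A] [Algebra A B] [Algebra R B] [IsScalarTower R A B] [Algebra.FormallySmooth A B]
    (D : Derivation R A B) : ∃ D' : Derivation R B B, ∀ a, D' (algebraMap A B a) = D a := by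
  obtain ⟨g, hg⟩ := LinearMap.exists_leftInverse_of_injective
    (KaehlerDifferential.mapBaseChange R A B)
    (LinearMap.ker_eq_bot.2 mapBaseChange_injective)
  let f : TensorProduct A B (Ω[A⁄R]) →ₗ[B] B :=
    LinearMap.liftBaseChange B D.liftKaehlerDifferential
  refine ⟨(f ∘ₗ g).compDer (KaehlerDifferential.D R B), fun a => ?_⟩
  have h1 : KaehlerDifferential.D R B (algebraMap A B a) =
      KaehlerDifferential.mapBaseChange R A B (1 ⊗ₜ KaehlerDifferential.D R A a) := by
    simp
  change f (g (KaehlerDifferential.D R B (algebraMap A B a))) = _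
  rw [h1, ← LinearMap.comp_apply g, hg]
  simp [f]

/-! ### Purely transcendental extensions from derivations -/

/-- The dual derivations act on polynomials in `y` as partial derivatives. So each partial
derivative of a relation is a relation of lower degree, hence zero by induction; in characteristic
zero the relation is then a constant. -/
theorem algebraicIndependent_of_derivations {k K ι : Type} [Field k] [CharZero k] [Field K]
    [Algebra k K] [DecidableEq ι] {y : ι → K}
    (h : ∀ i, ∃ D : Derivation k K K, ∀ j, D (y j) = if j = i then 1 else 0) :
    AlgebraicIndependent k y := by
  choose D hD using h
  have hder : ∀ i (p : MvPolynomial ι k), D i (aeval y p) = aeval y (pderiv i p) := by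
    intro i p
    induction p using MvPolynomial.induction_on with
    | C a => simp
    | add p q hp hq => simp only [map_add, hp, hq]
    | mul_X p j hp =>
      simp only [map_mul, aeval_X, Derivation.leibniz, hp, hD, pderiv_X, smul_eq_mul, map_add,
        Pi.single_apply]
      split_ifs <;> simp_all
  rw [AlgebraicIndependent, injective_iff_map_eq_zero]
  suffices H : ∀ (n : ℕ) (p : MvPolynomial ι k), p.totalDegree ≤ n → aeval y p = 0 → p = 0 from
    fun p hp => H _ p le_rfl hp
  intro n
  induction n with
  | zero =>
    intro p hp h0
    rw [Nat.le_zero, totalDegree_eq_zero_iff_eq_C] at hp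
    rw [hp, aeval_C] at h0
    rw [hp, (map_eq_zero _).1 h0, C_0]
  | succ n ih =>
    intro p hp h0
    have hcoeff : ∀ i (m : ι →₀ ℕ), coeff (m + Finsupp.single i 1) p = 0 := by
      intro i m
      have hz : pderiv i p = 0 := by
        refine ih _ ?_ (by rw [← hder, h0, map_zero])
        rw [totalDegree, Finset.sup_le_iff]
        intro m hm
        rw [mem_support_iff, coeff_pderiv] at hm
        have := (le_totalDegree (mem_support_iff.2 (left_ne_zero_of_mul hm))).trans hp
        rw [Finsupp.sum_add_index' (by simp) (by simp)] at this
        simpa using this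
      have h1 := coeff_pderiv (i := i) p m
      rw [hz, coeff_zero] at h1
      exact (mul_eq_zero.1 h1.symm).resolve_right (by exact_mod_cast Nat.succ_ne_zero (m i))
    refine ih p ?_ h0
    rw [totalDegree, Finset.sup_le_iff]
    intro m hm
    have hm0 : m = 0 := by
      by_contra hne
      obtain ⟨i, hi⟩ := Finsupp.ne_iff.1 hne
      have hle : Finsupp.single i 1 ≤ m := by
        rw [Finsupp.single_le_iff]
        exact Nat.one_le_iff_ne_zero.2 hi
      rw [mem_support_iff, ← tsub_add_cancel_of_le hle] at hm
      exact hm (hcoeff i _)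
    simp [hm0]

theorem derivation_eq_of_adjoin_eq_top {k K M : Type} [Field k] [Field K] [Algebra k K]
    [AddCommGroup M] [Module K M] [Module k M] [IsScalarTower k K M] {S : Set K}
    (hS : IntermediateField.adjoin k S = ⊤)
    {D₁ D₂ : Derivation k K M} (h : ∀ a ∈ S, D₁ a = D₂ a) : D₁ = D₂ := by
  ext a
  have ha : a ∈ IntermediateField.adjoin k S := hS ▸ IntermediateField.mem_top
  induction ha using IntermediateField.adjoin_induction with
  | mem x hx => exact h x hx
  | algebraMap x => simp
  | add x y _ _ hx hy => simp [hx, hy]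
  | inv x _ hx => simp [Derivation.leibniz_inv, hx]
  | mul x y _ _ hx hy => simp [Derivation.leibniz, hx, hy]

/-- A family generating a field extension whose size is at most the dimension of the space of
derivations is algebraically independent. -/
theorem algebraicIndependent_of_card_le_finrank {k K ι : Type} [Field k] [CharZero k] [Field K]
    [Algebra k K] [Fintype ι] [DecidableEq ι] {y : ι → K}
    (hy : IntermediateField.adjoin k (Set.range y) = ⊤)
    (hcard : Fintype.card ι ≤ Module.finrank K (Derivation k K K)) :
    AlgebraicIndependent k y := by
  -- A derivation is determined by its values on generators, so `f` is injective; the cardinality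
  -- bound makes it surjective, and preimages of the standard basis are the dual derivations.
  let f : Derivation k K K →ₗ[K] (ι → K) :=
    { toFun := fun D i => D (y i)
      map_add' := fun D₁ D₂ => rfl
      map_smul' := fun a D => rfl }
  have hinj : Function.Injective f := by
    intro D₁ D₂ h
    refine derivation_eq_of_adjoin_eq_top hy ?_
    rintro _ ⟨i, rfl⟩
    exact congrFun h i
  have : FiniteDimensional K (Derivation k K K) := Module.Finite.of_injective f hinj
  have hrange : LinearMap.range f = ⊤ := by
    apply Submodule.eq_top_of_finrank_eq
    apply le_antisymm (Submodule.finrank_le _)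
    rw [LinearMap.finrank_range_of_inj hinj, Module.finrank_fintype_fun_eq_card]
    exact hcard
  refine algebraicIndependent_of_derivations fun i => ?_
  obtain ⟨D, hD⟩ := LinearMap.range_eq_top.1 hrange (Pi.single i 1)
  refine ⟨D, fun j => ?_⟩
  rw [← Pi.single_apply]
  exact congrFun hD j

/-! ### Orthogonal complements and extension of scalars in coordinate spaces -/

section Orth

variable {k : Type} [Field k] {N : ℕ}

/-- The orthogonal complement with respect to the standard bilinear form. -/
def orth (S : Submodule k (Fin N → k)) : Submodule k (Fin N → k) where
  carrier := {z | ∀ e ∈ S, ∑ i, e i * z i = 0}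
  zero_mem' := fun e _ => by simp
  add_mem' := fun {a b} ha hb e he => by
    simp only [Pi.add_apply, mul_add, Finset.sum_add_distrib, ha e he, hb e he, add_zero]
  smul_mem' := fun r a ha e he => by
    simp only [Pi.smul_apply, smul_eq_mul, mul_left_comm _ r, ← Finset.mul_sum, ha e he, mul_zero]

theorem mem_orth {S : Submodule k (Fin N → k)} {z : Fin N → k} :
    z ∈ orth S ↔ ∀ e ∈ S, ∑ i, e i * z i = 0 :=
  Iff.rfl

theorem finrank_orth_add (S : Submodule k (Fin N → k)) :
    Module.finrank k (orth S) + Module.finrank k S = N := by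
  have h : orth S = S.dualAnnihilator.comap (dotProductEquiv k (Fin N)).toLinearMap := by
    ext z
    simp only [mem_orth, Submodule.mem_comap, Submodule.mem_dualAnnihilator]
    refine forall₂_congr fun e _ => ?_
    simp [dotProduct, mul_comm]
  have h2 : Module.finrank k (orth S) = Module.finrank k S.dualAnnihilator := by
    rw [h]
    have := Submodule.map_equiv_eq_comap_symm (dotProductEquiv k (Fin N)).symm S.dualAnnihilator
    rw [LinearEquiv.symm_symm] at this
    rw [← this]
    exact LinearEquiv.finrank_map_eq _ _
  have h3 := Subspace.finrank_add_finrank_dualAnnihilator_eq S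
  rw [Module.finrank_fintype_fun_eq_card, Fintype.card_fin] at h3
  omega

theorem orth_orth (S : Submodule k (Fin N → k)) : orth (orth S) = S := by
  symm
  apply Submodule.eq_of_le_of_finrank_eq
  · intro z hz e he
    simpa only [mul_comm] using he z hz
  · have := finrank_orth_add S
    have := finrank_orth_add (orth S)
    omega

theorem orth_le_orth {S T : Submodule k (Fin N → k)} (h : S ≤ T) : orth T ≤ orth S :=
  fun _ hz e he => hz e (h he)

variable (F : Type) [Field F] [Algebra k F]

/-- The `F`-subspace spanned by a `k`-subspace. -/
def scalarExt (S : Submodule k (Fin N → k)) : Submodule F (Fin N → F) :=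
  Submodule.span F ((fun v i => algebraMap k F (v i)) '' (S : Set (Fin N → k)))

variable {F}

theorem map_mem_scalarExt {S : Submodule k (Fin N → k)} {v : Fin N → k} (hv : v ∈ S) :
    (fun i => algebraMap k F (v i)) ∈ scalarExt F S :=
  Submodule.subset_span ⟨v, hv, rfl⟩

theorem scalarExt_mono {S T : Submodule k (Fin N → k)} (h : S ≤ T) :
    scalarExt F S ≤ scalarExt F T :=
  Submodule.span_mono (Set.image_mono h)

theorem finrank_scalarExt (S : Submodule k (Fin N → k)) :
    Module.finrank F (scalarExt F S) = Module.finrank k S := by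
  let b := Module.finBasis k S
  have hb : LinearIndependent k (fun i => (b i : Fin N → k)) :=
    b.linearIndependent.map' S.subtype S.ker_subtype
  have hb' : LinearIndependent F (fun i => algebraMap k F ∘ (b i : Fin N → k)) :=
    linearIndependent_algebraMap_comp_iff.2 hb
  have hspan : scalarExt F S =
      Submodule.span F (Set.range fun i => algebraMap k F ∘ (b i : Fin N → k)) := by
    apply le_antisymm
    · apply Submodule.span_le.2
      rintro _ ⟨v, hv, rfl⟩
      have h1 : v = ∑ i, b.repr ⟨v, hv⟩ i • (b i : Fin N → k) := by
        have := congrArg Subtype.val (b.sum_repr ⟨v, hv⟩)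
        refine this.symm.trans ?_
        rw [AddSubmonoidClass.coe_finsetSum]
        rfl
      have h2 : (fun i => algebraMap k F (v i)) =
          ∑ i, algebraMap k F (b.repr ⟨v, hv⟩ i) • (algebraMap k F ∘ (b i : Fin N → k)) := by
        funext j
        conv_lhs => rw [h1]
        simp [Algebra.smul_def]
      simp only [SetLike.mem_coe]
      rw [h2]
      exact Submodule.sum_mem _ fun i _ => Submodule.smul_mem _ _ (Submodule.subset_span ⟨i, rfl⟩)
    · apply Submodule.span_le.2
      rintro _ ⟨i, rfl⟩
      exact map_mem_scalarExt (b i).2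
  rw [hspan, finrank_span_eq_card hb', Fintype.card_fin]

theorem mem_orth_scalarExt {S : Submodule k (Fin N → k)} {z : Fin N → F} :
    z ∈ orth (scalarExt F S) ↔ ∀ e ∈ S, ∑ i, algebraMap k F (e i) * z i = 0 := by
  refine ⟨fun h e he => h _ (map_mem_scalarExt he), fun h e he => ?_⟩
  have hle : scalarExt F S ≤ orth (Submodule.span F {z}) := by
    apply Submodule.span_le.2
    rintro _ ⟨v, hv, rfl⟩ w hw
    obtain ⟨a, rfl⟩ := Submodule.mem_span_singleton.1 hw
    have := h v hv
    simp only [Pi.smul_apply, smul_eq_mul, mul_assoc, ← Finset.mul_sum]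
    simp only [mul_comm (z _), this, mul_zero]
  have := hle he z (Submodule.mem_span_singleton_self z)
  simpa only [mul_comm] using this

theorem orth_scalarExt (S : Submodule k (Fin N → k)) :
    orth (scalarExt F S) = scalarExt F (orth S) := by
  symm
  apply Submodule.eq_of_le_of_finrank_eq
  · apply Submodule.span_le.2
    rintro _ ⟨v, hv, rfl⟩
    rw [SetLike.mem_coe, mem_orth_scalarExt]
    intro e he
    have := congrArg (algebraMap k F) (hv e he)
    simpa using this
  · have h1 := finrank_orth_add (scalarExt F S)
    have h2 := finrank_orth_add S
    rw [finrank_scalarExt] at h1 ⊢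
    omega

/-- A subspace defined over `k` is cut out by equations with coefficients in `k`; derivations and
scalar extensions are tested on these equations. -/
theorem mem_scalarExt_iff {S : Submodule k (Fin N → k)} {z : Fin N → F} :
    z ∈ scalarExt F S ↔ ∀ e ∈ orth S, ∑ i, algebraMap k F (e i) * z i = 0 := by
  rw [← mem_orth_scalarExt, orth_scalarExt, orth_orth]

theorem map_mem_scalarExt_iff {S : Submodule k (Fin N → k)} {v : Fin N → k} :
    (fun i => algebraMap k F (v i)) ∈ scalarExt F S ↔ v ∈ S := by
  refine ⟨fun h => ?_, map_mem_scalarExt⟩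
  rw [← orth_orth S]
  intro e he
  apply (algebraMap k F).injective
  simpa using mem_scalarExt_iff.1 h e he

theorem scalarExt_inf (S T : Submodule k (Fin N → k)) :
    scalarExt F (S ⊓ T) = scalarExt F S ⊓ scalarExt F T := by
  apply le_antisymm (le_inf (scalarExt_mono inf_le_left) (scalarExt_mono inf_le_right))
  rintro z ⟨hS, hT⟩
  have h : S ⊓ T = orth (orth S ⊔ orth T) := by
    apply le_antisymm
    · rintro v ⟨hvS, hvT⟩ e he
      obtain ⟨a, ha, b, hb, rfl⟩ := Submodule.mem_sup.1 he
      have h1 := ha v hvS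
      have h2 := hb v hvT
      simp only [Pi.add_apply, add_mul, Finset.sum_add_distrib, mul_comm (a _), mul_comm (b _),
        h1, h2, add_zero]
    · refine le_inf ?_ ?_
      · exact (orth_le_orth le_sup_left).trans (orth_orth S).le
      · exact (orth_le_orth le_sup_right).trans (orth_orth T).le
  rw [h, ← orth_scalarExt, mem_orth_scalarExt]
  intro e he
  obtain ⟨a, ha, b, hb, rfl⟩ := Submodule.mem_sup.1 he
  have h1 := mem_scalarExt_iff.1 hS a ha
  have h2 := mem_scalarExt_iff.1 hT b hb
  simp only [Pi.add_apply, map_add, add_mul, Finset.sum_add_distrib, h1, h2, add_zero]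

/-- A derivation over `k` preserves subspaces defined over `k`. -/
theorem derivation_mem_scalarExt {S : Submodule k (Fin N → k)} (D : Derivation k F F)
    {z : Fin N → F} (hz : z ∈ scalarExt F S) : (fun i => D (z i)) ∈ scalarExt F S := by
  rw [mem_scalarExt_iff] at hz ⊢
  intro e he
  have := congrArg D (hz e he)
  simpa [Derivation.leibniz] using this

end Orth

section Tower

variable {k K F : Type} [Field k] [Field K] [Field F] [Algebra k K] [Algebra K F] [Algebra k F]
  [IsScalarTower k K F] {N : ℕ}

theorem scalarExt_scalarExt (S : Submodule k (Fin N → k)) :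
    scalarExt F (scalarExt K S) = scalarExt F S := by
  symm
  apply Submodule.eq_of_le_of_finrank_eq
  · apply Submodule.span_le.2
    rintro _ ⟨v, hv, rfl⟩
    have := map_mem_scalarExt (F := F) (map_mem_scalarExt (F := K) hv)
    simpa only [← IsScalarTower.algebraMap_apply, SetLike.mem_coe] using this
  · simp only [finrank_scalarExt]

end Tower

/-- The elements of `P` orthogonal to `S` under the pairing `(u, v) ↦ ∑ cᵢ uᵢ vᵢ`. -/
def pairingKer {F : Type} [Field F] {N : ℕ} (c : Fin N → F) (P S : Submodule F (Fin N → F)) :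
    Submodule F (Fin N → F) where
  carrier := {u | u ∈ P ∧ ∀ e ∈ S, ∑ i, c i * u i * e i = 0}
  zero_mem' := ⟨P.zero_mem, fun e _ => by simp⟩
  add_mem' := fun {a b} ha hb => ⟨P.add_mem ha.1 hb.1, fun e he => by
    simp only [Pi.add_apply, mul_add, add_mul, Finset.sum_add_distrib, ha.2 e he, hb.2 e he,
      add_zero]⟩
  smul_mem' := fun r a ha => ⟨P.smul_mem r ha.1, fun e he => by
    have : ∀ i, c i * (r • a) i * e i = r * (c i * a i * e i) := fun i => by
      simp only [Pi.smul_apply, smul_eq_mul]; ring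
    simp only [this, ← Finset.mul_sum, ha.2 e he, mul_zero]⟩

/-- The two kernels are those of a bilinear form and of its transpose, which have equal rank. -/
theorem finrank_pairingKer {F : Type} [Field F] {N : ℕ} (c : Fin N → F)
    (P S : Submodule F (Fin N → F)) :
    Module.finrank F (pairingKer c P S) + Module.finrank F S =
      Module.finrank F (pairingKer c S P) + Module.finrank F P := by
  let f : P →ₗ[F] Module.Dual F S := LinearMap.mk₂ F
    (fun (u : P) (e : S) => ∑ i, c i * u.1 i * e.1 i)
    (fun u v e => by simp [mul_add, add_mul, Finset.sum_add_distrib])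
    (fun r u e => by
      simp only [Submodule.coe_smul, Pi.smul_apply, smul_eq_mul, Finset.mul_sum]
      exact Finset.sum_congr rfl fun i _ => by ring)
    (fun u e e' => by simp [mul_add, Finset.sum_add_distrib])
    (fun r u e => by
      simp only [Submodule.coe_smul, Pi.smul_apply, smul_eq_mul, Finset.mul_sum]
      exact Finset.sum_congr rfl fun i _ => by ring)
  have hf : ∀ (u : P) (e : S), f u e = ∑ i, c i * u.1 i * e.1 i := fun u e => rfl
  let g : S →ₗ[F] Module.Dual F P := f.flip
  have hker : Module.finrank F (LinearMap.ker f) = Module.finrank F (pairingKer c P S) := by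
    have : pairingKer c P S = (LinearMap.ker f).map P.subtype := by
      ext u
      simp only [Submodule.mem_map, LinearMap.mem_ker, Submodule.subtype_apply, Subtype.exists,
        exists_and_right, exists_eq_right]
      constructor
      · rintro ⟨hu, h⟩
        exact ⟨hu, LinearMap.ext fun e => h e.1 e.2⟩
      · rintro ⟨hu, h⟩
        exact ⟨hu, fun e he => LinearMap.congr_fun h ⟨e, he⟩⟩
    rw [this, Submodule.finrank_map_subtype_eq]
  have hker' : Module.finrank F (LinearMap.ker g) = Module.finrank F (pairingKer c S P) := by
    have : pairingKer c S P = (LinearMap.ker g).map S.subtype := by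
      ext u
      simp only [Submodule.mem_map, LinearMap.mem_ker, Submodule.subtype_apply, Subtype.exists,
        exists_and_right, exists_eq_right]
      constructor
      · rintro ⟨hu, h⟩
        refine ⟨hu, LinearMap.ext fun e => ?_⟩
        rw [LinearMap.zero_apply, ← h e.1 e.2]
        change ∑ i, c i * e.1 i * u i = _
        exact Finset.sum_congr rfl fun i _ => by ring
      · rintro ⟨hu, h⟩
        refine ⟨hu, fun e he => ?_⟩
        have h' : ∑ i, c i * e i * u i = 0 := LinearMap.congr_fun h ⟨e, he⟩
        rw [← h']
        exact Finset.sum_congr rfl fun i _ => by ring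
    rw [this, Submodule.finrank_map_subtype_eq]
  have hrank : Module.finrank F (LinearMap.range f) = Module.finrank F (LinearMap.range g) := by
    have hg : g = f.dualMap ∘ₗ (Module.evalEquiv F S).toLinearMap := by
      ext e u
      rfl
    rw [hg, LinearMap.range_comp, LinearEquiv.range, Submodule.map_top,
      LinearMap.finrank_range_dualMap_eq_finrank_range]
  have h1 := f.finrank_range_add_finrank_ker
  have h2 := g.finrank_range_add_finrank_ker
  omega

end Cuspidal

namespace Cuspidal

/-! ### Points of subtori -/

/-- A point of a subtorus of dimension at most `r` is given by at most `r` coordinates. -/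
theorem exists_torus_coordinates {K : Type} [Field K] [Algebra ℂ K] {N r : ℕ}
    (E : Fin r → Fin N → ℤ) (z : Fin N → Kˣ)
    (hz : ∀ b : Fin N → ℤ, (∀ i, ∑ k, b k * E i k = 0) → ∏ k, z k ^ b k = 1) :
    ∃ (s : ℕ) (σ : Fin s → K), s ≤ r ∧
      ∀ k, (z k : K) ∈ IntermediateField.adjoin ℂ (Set.range σ) := by
  -- The character `b ↦ z^b` factors through the image of `φ`, which is free of rank at most `r`;
  -- its values on a basis are the required coordinates.
  let φ : (Fin N → ℤ) →ₗ[ℤ] (Fin r → ℤ) :=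
    { toFun := fun b i => ∑ k, b k * E i k
      map_add' := fun a b => by
        funext i; simp [add_mul, Finset.sum_add_distrib]
      map_smul' := fun a b => by
        funext i; simp [mul_assoc, Finset.mul_sum] }
  let χ : (Fin N → ℤ) → Kˣ := fun b => ∏ k, z k ^ b k
  have χ_add : ∀ a b, χ (a + b) = χ a * χ b := fun a b => by
    simp [χ, zpow_add, Finset.prod_mul_distrib]
  have χ_neg : ∀ a, χ (-a) = (χ a)⁻¹ := fun a => by simp [χ]
  have hχ : ∀ a b, φ a = φ b → χ a = χ b := by
    intro a b hab
    have h1 : χ (a + -b) = 1 := by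
      refine hz _ fun i => ?_
      have h2 : φ (a + -b) = 0 := by rw [map_add, map_neg, hab, add_neg_cancel]
      exact congrFun h2 i
    rw [χ_add, χ_neg] at h1
    exact mul_inv_eq_one.1 h1
  let b := Module.finBasis ℤ (LinearMap.range φ)
  have hpre : ∀ i, ∃ a, φ a = b i := fun i => (b i).2
  choose B hB using hpre
  refine ⟨_, fun i => (χ (B i) : K), ?_, fun k => ?_⟩
  · have := Submodule.finrank_le (LinearMap.range φ)
    simpa using this
  · have h1 : φ (Pi.single k 1) = φ (∑ i, b.repr ⟨φ (Pi.single k 1), _, rfl⟩ i • B i) := by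
      rw [map_sum]
      have := congrArg Subtype.val (b.sum_repr ⟨φ (Pi.single k 1), _, rfl⟩)
      refine this.symm.trans ?_
      rw [AddSubmonoidClass.coe_finsetSum]
      refine Finset.sum_congr rfl fun i _ => ?_
      rw [map_smul, hB]
      rfl
    have h2 : χ (Pi.single k 1) = z k := by
      simp only [χ]
      rw [Finset.prod_eq_single k]
      · simp
      · intro j _ hj
        simp [hj]
      · simp
    have χ_smul : ∀ (n : ℤ) a, χ (n • a) = χ a ^ n := fun n a => by
      simp [χ, mul_comm n, zpow_mul, Finset.prod_zpow]
    have χ_sum : ∀ (S : Finset (Fin (Module.finrank ℤ (LinearMap.range φ))))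
        (f : Fin (Module.finrank ℤ (LinearMap.range φ)) → Fin N → ℤ),
        χ (∑ i ∈ S, f i) = ∏ i ∈ S, χ (f i) := by
      intro S f
      induction S using Finset.induction_on with
      | empty => simp [χ]
      | insert a S ha ih => rw [Finset.sum_insert ha, Finset.prod_insert ha, χ_add, ih]
    rw [← h2, hχ _ _ h1, χ_sum, Units.coe_prod]
    refine prod_mem fun i _ => ?_
    rw [χ_smul, Units.val_zpow_eq_zpow_val]
    exact zpow_mem (IntermediateField.subset_adjoin ℂ _ (Set.mem_range_self i)) _

/-! ### Level sets of functions all of whose powers lie in a subspace defined over `ℂ` -/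

/-- Every polynomial in `u` lies in the extended subspace, and Lagrange interpolation writes the
indicator of a level set as such a polynomial. Its entries are complex, so it descends to `R`. -/
theorem indicator_mem_of_pow_mem {F : Type} [Field F] [Algebra ℂ F] {N : ℕ}
    {R : Submodule ℂ (Fin N → ℂ)} {u : Fin N → F} (hu : ∀ j : ℕ, u ^ j ∈ scalarExt F R)
    (a : F) [DecidableEq F] : (fun k => if u k = a then (1 : ℂ) else 0) ∈ R := by
  have hpoly : ∀ p : Polynomial F, (fun k => p.eval (u k)) ∈ scalarExt F R := by
    intro p
    have h : (fun k => p.eval (u k)) = ∑ j ∈ p.support, p.coeff j • u ^ j := by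
      funext k
      rw [Polynomial.eval_eq_sum, Polynomial.sum, Finset.sum_apply]
      rfl
    rw [h]
    exact Submodule.sum_mem _ fun j _ => Submodule.smul_mem _ _ (hu j)
  rw [← map_mem_scalarExt_iff (F := F)]
  let S : Finset F := insert a (Finset.univ.image u)
  have h := hpoly (Lagrange.basis S id a)
  convert h using 2 with k
  by_cases hk : u k = a
  · rw [if_pos hk, hk, map_one]
    exact (Lagrange.eval_basis_self Function.injective_id.injOn (by simp [S])).symm
  · rw [if_neg hk, map_zero]
    exact (Lagrange.eval_basis_of_ne (v := id) (Ne.symm hk) (by simp [S])).symm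

/-- Such functions satisfy all multiplicative relations given by integer vectors orthogonal to
the subspace. -/
theorem prod_zpow_eq_one_of_pow_mem {F : Type} [Field F] [Algebra ℂ F] {N : ℕ}
    {R : Submodule ℂ (Fin N → ℂ)} {u : Fin N → F} (hne : ∀ k, u k ≠ 0)
    (hu : ∀ j : ℕ, u ^ j ∈ scalarExt F R) {b : Fin N → ℤ} (hb : ∀ e ∈ R, ∑ k, (b k : ℂ) * e k = 0) : ∏ k, u k ^ b k = 1 := by
  classical
  -- On the level set of value `a` the product is `a` to the sum of the `b k`, and that sum is `b`
  -- paired with an indicator in `R`.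
  rw [← Finset.prod_fiberwise_of_maps_to (s := Finset.univ) (t := Finset.univ.image u) (g := u)
    (fun k hk => Finset.mem_image_of_mem u hk)]
  refine Finset.prod_eq_one fun a ha => ?_
  have h0 : ∑ k ∈ Finset.univ.filter (fun k => u k = a), b k = 0 := by
    have h1 := hb _ (indicator_mem_of_pow_mem hu a)
    simp only [mul_ite, mul_one, mul_zero, ← Finset.sum_filter] at h1
    exact_mod_cast h1
  have ha0 : a ≠ 0 := by
    obtain ⟨k, -, rfl⟩ := Finset.mem_image.1 ha
    exact hne k
  have hsum : ∀ S : Finset (Fin N), ∏ k ∈ S, a ^ b k = a ^ ∑ k ∈ S, b k := by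
    intro S
    induction S using Finset.induction_on with
    | empty => simp
    | insert k S hk ih => rw [Finset.prod_insert hk, Finset.sum_insert hk, zpow_add₀ ha0, ih]
  rw [Finset.prod_congr rfl (g := fun k => a ^ b k)
    (fun k hk => by rw [(Finset.mem_filter.1 hk).2]), hsum, h0, zpow_zero]

/-! ### Slicing a subspace -/

/-- Every subspace of a coordinate space is the graph of a linear map over some of the
coordinates. -/
theorem exists_coordinates {K : Type} [Field K] {q : ℕ} (W : Submodule K (Fin q → K)) :
    ∃ (κ : Type) (_ : Fintype κ) (a : κ → Fin q) (e : W ≃ₗ[K] (κ → K)), Function.Injective a ∧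
      Fintype.card κ = Module.finrank K W ∧ ∀ w i, e w i = (w : Fin q → K) (a i) := by
  -- The restricted coordinate functionals span the dual of `W`; a maximal independent subfamily is
  -- a basis of it.
  let coord : Fin q → Module.Dual K W := fun j => (LinearMap.proj j).comp W.subtype
  obtain ⟨κ, a, ha, hspan, hindep⟩ := exists_linearIndependent' K coord
  have : Fintype κ := Fintype.ofInjective a ha
  have htop : Submodule.span K (Set.range coord) = ⊤ := by
    rw [eq_top_iff]
    intro φ _
    obtain ⟨ψ, hψ⟩ := LinearMap.exists_extend φ
    have h : φ = ∑ j, ψ (fun i => if j = i then 1 else 0) • coord j := by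
      refine LinearMap.ext fun w => ?_
      rw [← hψ, LinearMap.comp_apply, LinearMap.pi_apply_eq_sum_univ ψ, LinearMap.sum_apply]
      exact Finset.sum_congr rfl fun j _ => mul_comm _ _
    rw [h]
    exact Submodule.sum_mem _ fun j _ =>
      Submodule.smul_mem _ _ (Submodule.subset_span (Set.mem_range_self j))
  have hcard : Fintype.card κ = Module.finrank K W := by
    rw [← finrank_span_eq_card hindep, hspan, htop, finrank_top, Subspace.dual_finrank_eq]
  let P : W →ₗ[K] (κ → K) := LinearMap.pi fun i => coord (a i)
  have hinj : Function.Injective P := by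
    rw [injective_iff_map_eq_zero]
    intro w hw
    have h : Submodule.span K (Set.range (coord ∘ a)) ≤
        LinearMap.ker (LinearMap.applyₗ (R := K) (M₂ := K) w) := by
      apply Submodule.span_le.2
      rintro _ ⟨i, rfl⟩
      exact congrFun hw i
    rw [hspan, htop] at h
    exact Subtype.ext (funext fun j => h (Submodule.mem_top (x := coord j)))
  have hP : Function.Bijective P :=
    ⟨hinj, (LinearMap.injective_iff_surjective_of_finrank_eq_finrank
      (by rw [Module.finrank_fintype_fun_eq_card, hcard])).1 hinj⟩
  exact ⟨κ, this, a, LinearEquiv.ofBijective P hP, ha, hcard, fun w i => rfl⟩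

/-- In a complex basis of `L`, the subspace `W` is a graph over `dim W` of the coordinates. Setting
these to complex constants leaves `dim L - dim W` coordinates `Y` of a vector of `W`, and a general
choice of constants avoids zero entries. -/
theorem exists_slice {K : Type} [Field K] [Algebra ℂ K] {N : ℕ} (L : Submodule ℂ (Fin N → ℂ))
    (W : Submodule K (Fin N → K)) (hW : W ≤ scalarExt K L) (hne : ∀ k, ∃ z ∈ W, z k ≠ 0) :
    ∃ (ι : Type) (_ : Fintype ι) (Y : ι → K) (c : Fin N → K), c ∈ W ∧ (∀ k, c k ≠ 0) ∧
      Fintype.card ι + Module.finrank K W = Module.finrank ℂ L ∧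
      ∀ k, c k ∈ IntermediateField.adjoin ℂ (Set.range Y) := by
  classical
  let v := Module.finBasis ℂ L
  set q := Module.finrank ℂ L with hq
  let T : (Fin q → K) →ₗ[K] (Fin N → K) :=
    Fintype.linearCombination K (fun j => (fun k => algebraMap ℂ K ((v j : Fin N → ℂ) k)))
  have hT : ∀ θ k, T θ k = ∑ j, θ j * algebraMap ℂ K ((v j : Fin N → ℂ) k) := by
    intro θ k
    simp [T, Fintype.linearCombination_apply]
  have hli : LinearIndependent K (fun j => ⇑(algebraMap ℂ K) ∘ (v j : Fin N → ℂ)) :=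
    linearIndependent_algebraMap_comp_iff.2 (v.linearIndependent.map' L.subtype L.ker_subtype)
  have hTinj : Function.Injective T := by
    rw [injective_iff_map_eq_zero]
    intro θ hθ
    exact funext (Fintype.linearIndependent_iff.1 hli θ hθ)
  have hTrange : LinearMap.range T = scalarExt K L := by
    apply Submodule.eq_of_le_of_finrank_eq
    · rintro _ ⟨θ, rfl⟩
      rw [Fintype.linearCombination_apply]
      exact Submodule.sum_mem _ fun j _ => Submodule.smul_mem _ _ (map_mem_scalarExt (F := K) (v j).2)
    · rw [LinearMap.finrank_range_of_inj hTinj, finrank_scalarExt, Module.finrank_fin_fun]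
  let W' := W.comap T
  have hW' : Module.finrank K W' = Module.finrank K W := by
    rw [(Submodule.equivMapOfInjective T hTinj W').finrank_eq,
      Submodule.map_comap_eq_of_le (hW.trans hTrange.ge)]
  obtain ⟨κ, _, a, e, ha, hcard, he⟩ := exists_coordinates W'
  rw [hW'] at hcard
  let Γ : (κ → ℂ) →ₗ[ℂ] (Fin N → K) :=
    { toFun := fun τ => T (e.symm fun i => algebraMap ℂ K (τ i))
      map_add' := fun τ τ' => by
        rw [← map_add, ← Submodule.coe_add, ← map_add]
        congr 3
        funext i
        simp
      map_smul' := fun r τ => by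
        have h : (fun i => algebraMap ℂ K ((r • τ) i)) =
            algebraMap ℂ K r • fun i => algebraMap ℂ K (τ i) := by
          funext i
          simp
        rw [h, map_smul, Submodule.coe_smul, map_smul, RingHom.id_apply, algebraMap_smul] }
  -- The vectors `Γ τ` span `W` over `K`, so an entry vanishing on all of them would vanish on `W`.
  have hΓ : ∀ k, ∃ τ, Γ τ k ≠ 0 := by
    intro k
    by_contra! hcon
    obtain ⟨z, hz, hzk⟩ := hne k
    obtain ⟨θ, rfl⟩ := hTrange.ge (hW hz)
    let f : (κ → K) →ₗ[K] K := LinearMap.proj k ∘ₗ T ∘ₗ W'.subtype ∘ₗ e.symm.toLinearMap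
    have hf : f = 0 := by
      refine LinearMap.pi_ext' fun i => LinearMap.ext_ring ?_
      have h1 : (fun j => algebraMap ℂ K ((Pi.single i 1 : κ → ℂ) j)) = Pi.single i 1 := by
        funext j
        by_cases hj : j = i
        · subst hj; simp
        · simp [hj]
      have h2 := hcon (Pi.single i 1)
      simp only [Γ, LinearMap.coe_mk, AddHom.coe_mk, h1] at h2
      exact h2
    apply hzk
    have h3 := LinearMap.congr_fun hf (e ⟨θ, hz⟩)
    simpa [f] using h3
  -- A vector space over an infinite field is not a finite union of proper subspaces.
  obtain ⟨τ, hτ⟩ : ∃ τ, ∀ k, Γ τ k ≠ 0 := by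
    by_contra! hcon
    obtain ⟨k, hk⟩ := Subspace.exists_eq_top_of_iUnion_eq_univ
      (p := fun k => LinearMap.ker ((LinearMap.proj k : (Fin N → K) →ₗ[ℂ] K) ∘ₗ Γ))
      (Set.eq_univ_of_forall fun τ => Set.mem_iUnion.2 (hcon τ))
    obtain ⟨τ, hτ⟩ := hΓ k
    exact hτ (LinearMap.mem_ker.1 (hk ▸ Submodule.mem_top (x := τ)))
  let θ : W' := e.symm fun i => algebraMap ℂ K (τ i)
  have hθ : ∀ i, (θ : Fin q → K) (a i) = algebraMap ℂ K (τ i) := by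
    intro i
    rw [← he, e.apply_symm_apply]
  refine ⟨{j // j ∉ Set.range a}, inferInstance, fun j => (θ : Fin q → K) j, Γ τ, θ.2, hτ, ?_, ?_⟩
  · rw [Fintype.card_subtype_compl, Fintype.card_fin, ← hcard,
      Set.card_range_of_injective ha]
    have := Fintype.card_le_of_injective a ha
    rw [Fintype.card_fin] at this
    omega
  · intro k
    change T θ k ∈ _
    rw [hT]
    refine sum_mem fun j _ => mul_mem ?_ (IntermediateField.algebraMap_mem _ _)
    by_cases hj : j ∈ Set.range a
    · obtain ⟨i, rfl⟩ := hj
      rw [hθ]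
      exact IntermediateField.algebraMap_mem _ _
    · exact IntermediateField.subset_adjoin ℂ _ ⟨⟨j, hj⟩, rfl⟩

end Cuspidal

noncomputable section

namespace Cuspidal

/-! ### Logarithmic derivations of a finitely generated field -/

section LogDer

variable {K F : Type} [Field K] [Algebra ℂ K] [Field F] [Algebra ℂ F] [Algebra K F]
  [IsScalarTower ℂ K F] {N : ℕ}

/-- The space of logarithmic derivatives `(D xₖ / xₖ)ₖ` for the derivations `D` of `K`. -/
def logDer (x : Fin N → K) : Submodule K (Fin N → K) :=
  LinearMap.range
    ({ toFun := fun D k => D (x k) / x k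
       map_add' := fun _ _ => funext fun _ => add_div _ _ _
       map_smul' := fun _ _ => funext fun _ => mul_div_assoc _ _ _ } :
      Derivation ℂ K K →ₗ[K] (Fin N → K))

theorem mem_logDer {x v : Fin N → K} :
    v ∈ logDer x ↔ ∃ D : Derivation ℂ K K, ∀ k, D (x k) / x k = v k :=
  ⟨fun ⟨D, hD⟩ => ⟨D, fun k => congrFun hD k⟩, fun ⟨D, hD⟩ => ⟨D, funext hD⟩⟩

theorem finrank_logDer {x : Fin N → K} (hx : IntermediateField.adjoin ℂ (Set.range x) = ⊤)
    (hx0 : ∀ k, x k ≠ 0) :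
    Module.finrank K (logDer x) = Module.finrank K (Derivation ℂ K K) := by
  apply LinearMap.finrank_range_of_inj
  intro D₁ D₂ h
  refine derivation_eq_of_adjoin_eq_top hx ?_
  rintro _ ⟨k, rfl⟩
  exact (div_left_inj' (hx0 k)).1 (congrFun h k)

/-- Composing `D` with the coordinate functionals of a `K`-basis of `F` gives derivations of `K`.
Testing on the orthogonal equations avoids any finiteness of `F` over `K`. -/
theorem logDer_mem_scalarExt (x : Fin N → K) (D : Derivation ℂ K F) :
    (fun k => D (x k) / algebraMap K F (x k)) ∈ scalarExt F (logDer x) := by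
  rw [mem_scalarExt_iff]
  intro z hz
  let b := Module.Basis.ofVectorSpace K F
  rw [← b.forall_coord_eq_zero_iff]
  intro j
  rw [← hz _ (mem_logDer.2 ⟨(b.coord j).compDer D, fun k => rfl⟩), map_sum]
  refine Finset.sum_congr rfl fun k _ => ?_
  have h : algebraMap K F (z k) * (D (x k) / algebraMap K F (x k)) =
      (z k / x k) • D (x k) := by
    rw [Algebra.smul_def, map_div₀]
    ring
  rw [h, map_smul, smul_eq_mul]
  change z k / x k * b.coord j (D (x k)) = b.coord j (D (x k)) / x k * z k
  ring

/-- Scaling vector fields with constant exponents preserve the conormal space. -/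
theorem derivation_orth_logDer {x : Fin N → K} (hx0 : ∀ k, x k ≠ 0) {e : Fin N → ℂ}
    {D : Derivation ℂ K K} (hD : ∀ k, D (x k) = algebraMap ℂ K (e k) * x k) {z : Fin N → K}
    (hz : z ∈ orth (logDer x)) : (fun k => D (z k)) ∈ orth (logDer x) := by
  intro v hv
  obtain ⟨D', hD'⟩ := mem_logDer.1 hv
  have h1 := congrArg D (hz v hv)
  have h2 := hz _ (mem_logDer.2 ⟨⁅D, D'⁆, fun k => rfl⟩)
  rw [map_zero, map_sum] at h1
  -- Since the exponents `e k` are constants, `D (D' xₖ / xₖ) = ⁅D, D'⁆ xₖ / xₖ`; the commutator is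
  -- a derivation, so its logarithmic derivative is orthogonal to `z`.
  have h3 : ∀ k, v k * D (z k) = D (v k * z k) - ⁅D, D'⁆ (x k) / x k * z k := by
    intro k
    have := hx0 k
    rw [← hD' k, Derivation.leibniz, Derivation.leibniz_div, Derivation.commutator_apply, hD,
      Derivation.leibniz, Derivation.map_algebraMap]
    simp only [smul_eq_mul, mul_zero, add_zero]
    field_simp
    ring
  rw [Finset.sum_congr rfl fun k _ => h3 k, Finset.sum_sub_distrib, h1, h2, sub_zero]

/-- On `K`, the derivation `D` is determined by its values on the generators `x`, so it is an
`F`-combination of scaling fields with constant exponents, each of which preserves the conormal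
space. -/
theorem derivation_scalarExt_orth_logDer {x : Fin N → K}
    (hx : IntermediateField.adjoin ℂ (Set.range x) = ⊤) (hx0 : ∀ k, x k ≠ 0)
    {R : Submodule ℂ (Fin N → ℂ)} (hR : ∀ e ∈ R, (fun k => algebraMap ℂ K (e k)) ∈ logDer x)
    {g : Fin N → F} (hg : g ∈ scalarExt F R) {D : Derivation ℂ K F}
    (hD : ∀ k, D (x k) = g k * algebraMap K F (x k)) {z : Fin N → K}
    (hz : z ∈ orth (logDer x)) : (fun k => D (z k)) ∈ scalarExt F (orth (logDer x)) := by
  have key : ∃ D' : Derivation ℂ K F, (∀ k, D' (x k) = g k * algebraMap K F (x k)) ∧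
      (fun k => D' (z k)) ∈ scalarExt F (orth (logDer x)) := by
    clear hD
    induction hg using Submodule.span_induction with
    | mem g hg =>
      obtain ⟨e, he, rfl⟩ := hg
      obtain ⟨D', hD'⟩ := mem_logDer.1 (hR e he)
      have hD'' : ∀ k, D' (x k) = algebraMap ℂ K (e k) * x k := fun k =>
        (div_eq_iff (hx0 k)).1 (hD' k)
      refine ⟨(Algebra.linearMap K F).compDer D', fun k => ?_, ?_⟩
      · change algebraMap K F (D' (x k)) = _
        rw [hD'', map_mul, ← IsScalarTower.algebraMap_apply]
      · exact map_mem_scalarExt (derivation_orth_logDer hx0 hD'' hz)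
    | zero => exact ⟨0, fun k => by simp, Submodule.zero_mem (scalarExt F (orth (logDer x)))⟩
    | add g₁ g₂ _ _ h₁ h₂ =>
      obtain ⟨D₁, h₁, h₁'⟩ := h₁
      obtain ⟨D₂, h₂, h₂'⟩ := h₂
      refine ⟨D₁ + D₂, fun k => ?_, Submodule.add_mem _ h₁' h₂'⟩
      rw [Derivation.add_apply, h₁, h₂, Pi.add_apply, add_mul]
    | smul a g _ h =>
      obtain ⟨D₁, h₁, h₁'⟩ := h
      refine ⟨a • D₁, fun k => ?_, Submodule.smul_mem _ a h₁'⟩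
      rw [Derivation.smul_apply, h₁, Pi.smul_apply, smul_eq_mul, smul_eq_mul, mul_assoc]
  obtain ⟨D', h1, h2⟩ := key
  have : D = D' := by
    refine derivation_eq_of_adjoin_eq_top hx ?_
    rintro _ ⟨k, rfl⟩
    rw [hD, h1]
  rwa [this]

end LogDer

/-! ### Generic points of Horn–Kapranov type -/

/-- The linear span of the rows of an integer matrix. -/
def rowSpan {r N : ℕ} (A : Fin r → Fin N → ℤ) : Submodule ℂ (Fin N → ℂ) :=
  Submodule.span ℂ (Set.range fun i k => (A i k : ℂ))

/-- The point `(cₖ s^αₖ)ₖ`. -/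
def hornPoint {F : Type} [Field F] {r N : ℕ} (A : Fin r → Fin N → ℤ) (s : Fin r → F)
    (c : Fin N → F) : Fin N → F :=
  fun k => c k * ∏ i, s i ^ A i k

/-- `s` is a generic point of a torus and `c` is a generic point of the linear space `L`,
which has codimension one in the orthogonal complement of the rows of `A`. -/
structure IsGenericHorn {F : Type} [Field F] [Algebra ℂ F] {r N : ℕ} (A : Fin r → Fin N → ℤ)
    (L : Submodule ℂ (Fin N → ℂ)) (s : Fin r → F) (c : Fin N → F) : Prop where
  s_ne : ∀ i, s i ≠ 0
  c_ne : ∀ k, c k ≠ 0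
  c_mem : c ∈ scalarExt F L
  exists_derivation : ∀ τ ∈ scalarExt F L, ∀ δ : Fin r → F,
    ∃ D : Derivation ℂ F F, (∀ k, D (c k) = τ k) ∧ ∀ i, D (s i) = δ i * s i
  extend : ∀ (K : IntermediateField ℂ F) (D : Derivation ℂ K F),
    ∃ D' : Derivation ℂ F F, ∀ a : K, D' a = D a
  row_le : rowSpan A ≤ orth L
  one_mem : (fun _ => 1) ∈ rowSpan A
  finrank_row : Module.finrank ℂ (rowSpan A) = r
  finrank_orth : Module.finrank ℂ (orth L) = r + 1

namespace IsGenericHorn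

variable {F : Type} [Field F] [Algebra ℂ F] {r N : ℕ} {A : Fin r → Fin N → ℤ}
    {L : Submodule ℂ (Fin N → ℂ)} {s : Fin r → F} {c : Fin N → F}

theorem hornPoint_ne_zero (h : IsGenericHorn A L s c) (k : Fin N) : hornPoint A s c k ≠ 0 :=
  mul_ne_zero (h.c_ne k) (Finset.prod_ne_zero_iff.2 fun i _ => zpow_ne_zero _ (h.s_ne i))

theorem derivation_hornPoint (h : IsGenericHorn A L s c) {D : Derivation ℂ F F} {δ : Fin r → F}
    (hs : ∀ i, D (s i) = δ i * s i) (k : Fin N) :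
    D (hornPoint A s c k) / hornPoint A s c k = D (c k) / c k + ∑ i, δ i * (A i k : F) := by
  have hmon : ∀ S : Finset (Fin r), D (∏ i ∈ S, s i ^ A i k) =
      (∑ i ∈ S, δ i * (A i k : F)) * ∏ i ∈ S, s i ^ A i k := by
    intro S
    induction S using Finset.induction_on with
    | empty => simp
    | insert i S hi ih =>
      rw [Finset.prod_insert hi, Finset.sum_insert hi, Derivation.leibniz, ih,
        Derivation.leibniz_zpow, hs]
      have hz : s i ^ (A i k - 1) * s i = s i ^ A i k := by
        rw [← zpow_add_one₀ (h.s_ne i), sub_add_cancel]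
      simp only [smul_eq_mul, zsmul_eq_mul]
      linear_combination (∏ x ∈ S, s x ^ A x k) * (A i k : F) * δ i * hz
  have hne := h.hornPoint_ne_zero k
  have hc := h.c_ne k
  rw [hornPoint] at hne ⊢
  rw [Derivation.leibniz, hmon, smul_eq_mul, smul_eq_mul]
  have hp := right_ne_zero_of_mul hne
  field_simp
  ring

/-- The function field of the image. -/
abbrev functionField (A : Fin r → Fin N → ℤ) (s : Fin r → F) (c : Fin N → F) :
    IntermediateField ℂ F :=
  IntermediateField.adjoin ℂ (Set.range (hornPoint A s c))

/-- The coordinates of the generic point of the image in its function field. -/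
def coordinate (A : Fin r → Fin N → ℤ) (s : Fin r → F) (c : Fin N → F) (k : Fin N) :
    functionField A s c :=
  ⟨hornPoint A s c k, IntermediateField.subset_adjoin ℂ _ ⟨k, rfl⟩⟩

theorem coordinate_ne_zero (h : IsGenericHorn A L s c) (k : Fin N) : coordinate A s c k ≠ 0 :=
  fun h0 => h.hornPoint_ne_zero k (congrArg Subtype.val h0)

theorem adjoin_coordinate (A : Fin r → Fin N → ℤ) (s : Fin r → F) (c : Fin N → F) :
    IntermediateField.adjoin ℂ (Set.range (coordinate A s c)) = ⊤ := by
  apply IntermediateField.lift_injective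
  rw [IntermediateField.lift_adjoin, IntermediateField.lift_top, ← Set.range_comp]
  rfl

theorem sum_row_mul_eq_zero {z : Fin N → F} (hz : z ∈ orth (scalarExt F (rowSpan A)))
    (δ : Fin r → F) : ∑ k, z k * ∑ i, δ i * (A i k : F) = 0 := by
  simp only [Finset.mul_sum]
  rw [Finset.sum_comm]
  refine Finset.sum_eq_zero fun i _ => ?_
  have h1 := mem_orth_scalarExt.1 hz _ (Submodule.subset_span (Set.mem_range_self i))
  simp only [map_intCast] at h1
  have h2 : ∀ k, z k * (δ i * (A i k : F)) = δ i * ((A i k : F) * z k) := fun k => by ring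
  simp only [h2, ← Finset.mul_sum, h1, mul_zero]

theorem mem_orth_row {z : Fin N → F} (hz : ∀ i, ∑ k, (A i k : F) * z k = 0) :
    z ∈ orth (scalarExt F (rowSpan A)) := by
  rw [mem_orth_scalarExt]
  intro e he
  induction he using Submodule.span_induction with
  | mem e he =>
    obtain ⟨i, rfl⟩ := he
    simpa using hz i
  | zero => simp
  | add a b _ _ ha hb => simp [add_mul, Finset.sum_add_distrib, ha, hb]
  | smul t a _ ha =>
    simp only [Pi.smul_apply, smul_eq_mul, map_mul, mul_assoc, ← Finset.mul_sum, ha, mul_zero]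

/-- The conormal space of the image at its generic point. -/
theorem mem_conormal_iff (h : IsGenericHorn A L s c) {u : Fin N → F} :
    c * u ∈ scalarExt F (orth (logDer (coordinate A s c))) ↔
      u ∈ pairingKer c (scalarExt F (orth L)) (scalarExt F (rowSpan A)) := by
  have hrow : (∀ e ∈ scalarExt F (rowSpan A), ∑ i, c i * u i * e i = 0) ↔
      c * u ∈ orth (scalarExt F (rowSpan A)) := by
    refine forall₂_congr fun e _ => ?_
    simp only [Pi.mul_apply, mul_comm (e _)]
  constructor
  · intro hz
    rw [← orth_scalarExt] at hz
    -- Restricting derivations of `F` to the function field gives tangent vectors; moving `c` and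
    -- `s` independently yields the two orthogonality conditions.
    have hD : ∀ D : Derivation ℂ F F, ∑ k,
        D (hornPoint A s c k) / hornPoint A s c k * (c k * u k) = 0 := fun D =>
      hz _ (logDer_mem_scalarExt (coordinate A s c) (D.compAlgebraMap (functionField A s c)))
    have hD' : ∀ τ ∈ scalarExt F L, ∀ δ : Fin r → F,
        ∑ k, (τ k / c k + ∑ i, δ i * (A i k : F)) * (c k * u k) = 0 := by
      intro τ hτ δ
      obtain ⟨D, h1, h2⟩ := h.exists_derivation τ hτ δ
      rw [← hD D]
      refine Finset.sum_congr rfl fun k _ => ?_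
      rw [h.derivation_hornPoint h2, h1]
    refine ⟨?_, hrow.2 (mem_orth_row fun i => ?_)⟩
    · rw [← orth_scalarExt]
      intro τ hτ
      rw [← hD' τ hτ 0]
      refine Finset.sum_congr rfl fun k _ => ?_
      have := h.c_ne k
      simp only [Pi.zero_apply, zero_mul, Finset.sum_const_zero, add_zero]
      field_simp
    · rw [← hD' 0 (Submodule.zero_mem _) (Pi.single i 1)]
      refine Finset.sum_congr rfl fun k _ => ?_
      simp [Pi.single_apply]
  · rintro ⟨hu, hu'⟩
    rw [hrow] at hu'
    rw [← orth_scalarExt, mem_orth_scalarExt]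
    intro v hv
    obtain ⟨D₀, hD₀⟩ := mem_logDer.1 hv
    -- Conversely every tangent vector comes from the parameters, because a derivation of the
    -- function field extends to `F`.
    obtain ⟨D, hD⟩ := h.extend (functionField A s c)
      ((Algebra.linearMap (functionField A s c) F).compDer D₀)
    have h1 : ∀ k, algebraMap (functionField A s c) F (v k) =
        D (hornPoint A s c k) / hornPoint A s c k := by
      intro k
      rw [← hD₀ k, map_div₀]
      have := hD (coordinate A s c k)
      exact congrArg (· / hornPoint A s c k) this.symm
    have h2 : ∀ k, D (hornPoint A s c k) / hornPoint A s c k = D (c k) / c k +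
        ∑ i, D (s i) / s i * (A i k : F) := h.derivation_hornPoint fun i => by
      rw [div_mul_cancel₀ _ (h.s_ne i)]
    have h3 := sum_row_mul_eq_zero hu' fun i => D (s i) / s i
    rw [← orth_scalarExt] at hu
    have h4 := hu _ (derivation_mem_scalarExt D h.c_mem)
    rw [← add_zero (0 : F)]
    nth_rw 1 [← h4]
    rw [← h3, ← Finset.sum_add_distrib]
    refine Finset.sum_congr rfl fun k _ => ?_
    rw [h1, h2, Pi.mul_apply]
    have := h.c_ne k
    field_simp

end IsGenericHorn

end Cuspidal

end

/-! ### The radical of the pairing and its powers -/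

noncomputable section

namespace Cuspidal

theorem finrank_eq_of_mul_mem_iff {F : Type} [Field F] {N : ℕ} {c : Fin N → F}
    (hc : ∀ k, c k ≠ 0) {S T : Submodule F (Fin N → F)} (h : ∀ u, c * u ∈ S ↔ u ∈ T) :
    Module.finrank F S = Module.finrank F T := by
  have hinj : Function.Injective (LinearMap.mulLeft F c) := by
    intro a b hab
    funext k
    exact mul_left_cancel₀ (hc k) (congrFun hab k)
  have hST : S = T.map (LinearMap.mulLeft F c) := by
    ext z
    rw [Submodule.mem_map]
    constructor
    · intro hz
      have hz' : c * (fun k => z k / c k) = z := funext fun k => mul_div_cancel₀ _ (hc k)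
      exact ⟨_, (h _).1 (hz'.symm ▸ hz), hz'⟩
    · rintro ⟨u, hu, rfl⟩
      exact (h u).2 hu
  rw [hST]
  exact (Submodule.equivMapOfInjective _ hinj T).finrank_eq.symm

namespace IsGenericHorn

variable {F : Type} [Field F] [Algebra ℂ F] {r N : ℕ} {A : Fin r → Fin N → ℤ}
    {L : Submodule ℂ (Fin N → ℂ)} {s : Fin r → F} {c : Fin N → F}

/-- The part of the conormal space of the image that lies in `L`. -/
def conormalMeet (A : Fin r → Fin N → ℤ) (L : Submodule ℂ (Fin N → ℂ)) (s : Fin r → F)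
    (c : Fin N → F) : Submodule (functionField A s c) (Fin N → functionField A s c) :=
  orth (logDer (coordinate A s c)) ⊓ scalarExt (functionField A s c) L

/-- That `c u` lies in the extension of `L` means that `u` pairs to zero with all of `orth L`; this
contains the row span, so it subsumes the pairing condition for conormality. The radical, a priori
an object over `F`, thus comes from the function field. -/
theorem mem_conormalMeet_iff (h : IsGenericHorn A L s c) {u : Fin N → F} :
    c * u ∈ scalarExt F (conormalMeet A L s c) ↔
      u ∈ pairingKer c (scalarExt F (orth L)) (scalarExt F (orth L)) := by
  rw [conormalMeet, scalarExt_inf, scalarExt_scalarExt, Submodule.mem_inf, h.mem_conormal_iff]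
  have h1 : c * u ∈ scalarExt F L ↔
      ∀ e ∈ scalarExt F (orth L), ∑ i, c i * u i * e i = 0 := by
    rw [← orth_orth (scalarExt F L), orth_scalarExt, mem_orth]
    refine forall₂_congr fun e _ => ?_
    simp only [Pi.mul_apply, mul_comm (e _)]
  rw [h1]
  exact ⟨fun ⟨⟨h2, _⟩, h3⟩ => ⟨h2, h3⟩,
    fun ⟨h2, h3⟩ => ⟨⟨h2, fun e he => h3 e (scalarExt_mono h.row_le he)⟩, h3⟩⟩

theorem one_mem_pairingKer (h : IsGenericHorn A L s c) :
    (1 : Fin N → F) ∈ pairingKer c (scalarExt F (orth L)) (scalarExt F (orth L)) := by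
  constructor
  · have := map_mem_scalarExt (F := F) (h.row_le h.one_mem)
    simp only [map_one] at this
    exact this
  · intro e he
    rw [← orth_scalarExt] at he
    rw [← he c h.c_mem]
    exact Finset.sum_congr rfl fun i _ => by simp

theorem finrank_orth_logDer (h : IsGenericHorn A L s c) :
    Module.finrank (functionField A s c) (orth (logDer (coordinate A s c))) =
      Module.finrank F (pairingKer c (scalarExt F (orth L)) (scalarExt F (rowSpan A))) := by
  rw [← finrank_scalarExt (F := F)]
  exact finrank_eq_of_mul_mem_iff h.c_ne fun u => h.mem_conormal_iff

theorem finrank_conormalMeet (h : IsGenericHorn A L s c) :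
    Module.finrank (functionField A s c) (conormalMeet A L s c) =
      Module.finrank F (pairingKer c (scalarExt F (orth L)) (scalarExt F (orth L))) := by
  rw [← finrank_scalarExt (F := F)]
  exact finrank_eq_of_mul_mem_iff h.c_ne fun u => h.mem_conormalMeet_iff

section Invariant

variable {R : Submodule ℂ (Fin N → ℂ)}

/-- Orthogonality to the whole conormal space is tangency: the scalings with exponents in `R` act
infinitesimally on the image. -/
theorem mem_logDer_of_pairing (h : IsGenericHorn A L s c)
    (hR : ∀ u ∈ pairingKer c (scalarExt F (orth L)) (scalarExt F (rowSpan A)), ∀ e ∈ R,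
      ∑ k, c k * u k * algebraMap ℂ F (e k) = 0) {e : Fin N → ℂ} (he : e ∈ R) :
    (fun k => algebraMap ℂ (functionField A s c) (e k)) ∈ logDer (coordinate A s c) := by
  rw [← orth_orth (logDer _)]
  intro z hz
  have hz' : c * (fun k => (z k : F) / c k) = fun k => (z k : F) :=
    funext fun k => mul_div_cancel₀ _ (h.c_ne k)
  have h1 := hR _ (h.mem_conormal_iff.1 (hz'.symm ▸ map_mem_scalarExt (F := F) hz)) e he
  apply (algebraMap (functionField A s c) F).injective
  rw [map_sum, map_zero, ← h1]
  refine Finset.sum_congr rfl fun k _ => ?_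
  rw [map_mul, ← IsScalarTower.algebraMap_apply, mul_div_cancel₀ _ (h.c_ne k)]
  rfl

/-- Move `c` in the direction `c g`, which lies in the extension of `L`, and keep `s` fixed. Then `D
x = g x`, so by `hW` the field `D` is a combination of tangent scalings and preserves the conormal
space as well as `L`. Dividing `D (c u) = c (D u + g u)` by `c` gives the claim. -/
theorem exists_derivation_pairingKer (h : IsGenericHorn A L s c)
    (hR : ∀ u ∈ pairingKer c (scalarExt F (orth L)) (scalarExt F (rowSpan A)), ∀ e ∈ R,
      ∑ k, c k * u k * algebraMap ℂ F (e k) = 0)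
    (hW : pairingKer c (scalarExt F (orth L)) (scalarExt F (orth L)) ≤ scalarExt F R)
    {g : Fin N → F} (hg : g ∈ pairingKer c (scalarExt F (orth L)) (scalarExt F (orth L))) :
    ∃ D : Derivation ℂ F F, ∀ u ∈ pairingKer c (scalarExt F (orth L)) (scalarExt F (orth L)),
      (fun k => D (u k)) + g * u ∈
        pairingKer c (scalarExt F (orth L)) (scalarExt F (orth L)) := by
  have hcg : c * g ∈ scalarExt F L := by
    have := h.mem_conormalMeet_iff.2 hg
    rw [conormalMeet, scalarExt_inf, scalarExt_scalarExt] at this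
    exact this.2
  obtain ⟨D, hDc, hDs⟩ := h.exists_derivation (c * g) hcg 0
  have hDx : ∀ k, D (hornPoint A s c k) = g k * hornPoint A s c k := by
    intro k
    rw [← div_eq_iff (h.hornPoint_ne_zero k), h.derivation_hornPoint hDs, hDc]
    simp [h.c_ne k]
  refine ⟨D, fun u hu => ?_⟩
  rw [← h.mem_conormalMeet_iff] at hu ⊢
  have hDu : (fun k => D ((c * u) k)) ∈ scalarExt F (conormalMeet A L s c) := by
    generalize c * u = w at hu ⊢
    rw [conormalMeet, scalarExt_inf, scalarExt_scalarExt] at hu ⊢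
    have hu2 := derivation_mem_scalarExt D hu.2
    refine ⟨?_, hu2⟩
    clear hu2
    obtain ⟨hu1, -⟩ := hu
    rw [SetLike.mem_coe] at hu1 ⊢
    induction hu1 using Submodule.span_induction with
    | mem v hv =>
      obtain ⟨z, hz, rfl⟩ := hv
      exact derivation_scalarExt_orth_logDer (adjoin_coordinate A s c) h.coordinate_ne_zero
        (fun e he => h.mem_logDer_of_pairing hR he) (hW hg)
        (D := D.compAlgebraMap (functionField A s c)) hDx hz
    | zero =>
      simp only [Pi.zero_apply, map_zero]
      exact Submodule.zero_mem _
    | add a b _ _ ha hb =>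
      simp only [Pi.add_apply, map_add]
      exact Submodule.add_mem _ ha hb
    | smul t a hmem ha =>
      have h1 : (fun k => D ((t • a) k)) = D t • a + t • fun k => D (a k) := by
        funext k
        simp only [Pi.smul_apply, Pi.add_apply, smul_eq_mul, Derivation.leibniz]
        ring
      rw [h1]
      exact Submodule.add_mem _ (Submodule.smul_mem _ _ hmem) (Submodule.smul_mem _ _ ha)
  convert hDu using 1
  funext k
  simp only [Pi.mul_apply, Pi.add_apply, Derivation.leibniz, smul_eq_mul, hDc]
  ring

/-- All products of elements of the kernel of the pairing stay in a fixed subspace defined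
over `ℂ`. -/
theorem pow_le_scalarExt (h : IsGenericHorn A L s c)
    (hR : ∀ u ∈ pairingKer c (scalarExt F (orth L)) (scalarExt F (rowSpan A)), ∀ e ∈ R,
      ∑ k, c k * u k * algebraMap ℂ F (e k) = 0)
    (hW : pairingKer c (scalarExt F (orth L)) (scalarExt F (orth L)) ≤ scalarExt F R) (j : ℕ) :
    pairingKer c (scalarExt F (orth L)) (scalarExt F (orth L)) ^ (j + 1) ≤ scalarExt F R := by
  set W := pairingKer c (scalarExt F (orth L)) (scalarExt F (orth L)) with hWdef
  have : CharZero F := charZero_of_injective_algebraMap (algebraMap ℂ F).injective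
  -- The inclusion alone does not propagate: the induction also carries that a derivation twisting
  -- `W` by `g` twists `W ^ (j + 1)` by `(j + 1) g`.
  suffices H : W ^ (j + 1) ≤ scalarExt F R ∧ ∀ (D : Derivation ℂ F F) (g : Fin N → F),
      (∀ u ∈ W, (fun k => D (u k)) + g * u ∈ W) → ∀ p ∈ W ^ (j + 1),
        (fun k => D (p k)) + ((j + 1 : ℕ) : F) • (g * p) ∈ W ^ (j + 1) from H.1
  induction j with
  | zero =>
    simp only [zero_add, pow_one, Nat.cast_one, one_smul]
    exact ⟨hW, fun D g hD p hp => hD p hp⟩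
  | succ j ih =>
    obtain ⟨ih1, ih2⟩ := ih
    rw [pow_succ]
    constructor
    · rw [Submodule.mul_le]
      intro a ha b hb
      obtain ⟨D, hD⟩ := h.exists_derivation_pairingKer hR hW hb
      -- Both `D a + (j + 1) b a` and `D a` lie in the extension of `R`, the latter because `R` is
      -- defined over `ℂ`; subtract and divide by `j + 1`.
      have h1 := ih1 (ih2 D b hD a ha)
      have h2 := derivation_mem_scalarExt D (ih1 ha)
      have h3 := Submodule.smul_mem _ (((j + 1 : ℕ) : F)⁻¹) (Submodule.sub_mem _ h1 h2)
      rw [add_sub_cancel_left, smul_smul, inv_mul_cancel₀ (Nat.cast_ne_zero.2 j.succ_ne_zero),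
        one_smul, mul_comm] at h3
      exact h3
    · intro D g hD p hp
      induction hp using Submodule.mul_induction_on' with
      | mem_mul_mem a ha b hb =>
        have h1 := Submodule.mul_mem_mul ha (hD b hb)
        have h2 := Submodule.mul_mem_mul (ih2 D g hD a ha) hb
        convert Submodule.add_mem _ h1 h2 using 1
        funext k
        simp only [Pi.mul_apply, Pi.add_apply, Derivation.leibniz, smul_eq_mul, Pi.smul_apply]
        push_cast
        ring
      | add a _ b _ ha hb =>
        convert Submodule.add_mem _ ha hb using 1
        funext k
        simp only [Pi.mul_apply, Pi.add_apply, map_add, smul_eq_mul, Pi.smul_apply]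
        ring

theorem pow_mem_scalarExt (h : IsGenericHorn A L s c)
    (hR : ∀ u ∈ pairingKer c (scalarExt F (orth L)) (scalarExt F (rowSpan A)), ∀ e ∈ R,
      ∑ k, c k * u k * algebraMap ℂ F (e k) = 0)
    (hW : pairingKer c (scalarExt F (orth L)) (scalarExt F (orth L)) ≤ scalarExt F R)
    {u : Fin N → F} (hu : u ∈ pairingKer c (scalarExt F (orth L)) (scalarExt F (orth L)))
    (j : ℕ) : u ^ j ∈ scalarExt F R := by
  cases j with
  | zero =>
    rw [pow_zero]
    exact hW h.one_mem_pairingKer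
  | succ j => exact h.pow_le_scalarExt hR hW j (Submodule.pow_mem_pow _ hu _)

end Invariant

end IsGenericHorn

end Cuspidal

end

/-! ### Generators of the function field and pure transcendence -/

noncomputable section

namespace Cuspidal

theorem sum_mul_eq_zero_of_mem_rowSpan {r N : ℕ} {E : Fin r → Fin N → ℤ} {b : Fin N → ℤ}
    (hb : ∀ i, ∑ k, b k * E i k = 0) {e : Fin N → ℂ} (he : e ∈ rowSpan E) :
    ∑ k, (b k : ℂ) * e k = 0 := by
  induction he using Submodule.span_induction with
  | mem e he =>
    obtain ⟨i, rfl⟩ := he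
    have := congrArg (Int.cast : ℤ → ℂ) (hb i)
    push_cast at this
    exact this
  | zero => simp
  | add x y _ _ hx hy => simp [mul_add, Finset.sum_add_distrib, hx, hy]
  | smul t x _ hx =>
    simp only [Pi.smul_apply, smul_eq_mul, mul_left_comm _ t, ← Finset.mul_sum, hx, mul_zero]

namespace IsGenericHorn

variable {F : Type} [Field F] [Algebra ℂ F] {r N : ℕ} {A : Fin r → Fin N → ℤ}
    {L : Submodule ℂ (Fin N → ℂ)} {s : Fin r → F} {c : Fin N → F}

/-- Over `F` the extended space contains `c` itself, as `1` is in the radical, and `c` has no zero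
entry. -/
theorem exists_mem_conormalMeet_ne_zero (h : IsGenericHorn A L s c) (k : Fin N) :
    ∃ z ∈ conormalMeet A L s c, z k ≠ 0 := by
  by_contra! hcon
  have hle : scalarExt F (conormalMeet A L s c) ≤
      LinearMap.ker (LinearMap.proj k : (Fin N → F) →ₗ[F] F) := by
    apply Submodule.span_le.2
    rintro _ ⟨z, hz, rfl⟩
    simp [hcon z hz]
  have h1 := hle (h.mem_conormalMeet_iff.2 h.one_mem_pairingKer)
  rw [mul_one] at h1
  exact h.c_ne k h1

/-- The monomials of a point of the subtorus with exponents `A` satisfy the relations of `A`. -/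
theorem prod_hornPoint_zpow (h : IsGenericHorn A L s c) {b : Fin N → ℤ}
    (hb : ∀ i, ∑ k, b k * A i k = 0) :
    ∏ k, (∏ i, s i ^ A i k) ^ b k = 1 := by
  simp only [← Finset.prod_zpow, ← zpow_mul]
  rw [Finset.prod_comm]
  refine Finset.prod_eq_one fun i _ => ?_
  have hsum : ∀ S : Finset (Fin N), ∏ k ∈ S, s i ^ (A i k * b k) =
      s i ^ ∑ k ∈ S, A i k * b k := by
    intro S
    induction S using Finset.induction_on with
    | empty => simp
    | insert k S hk ih =>
      rw [Finset.prod_insert hk, Finset.sum_insert hk, zpow_add₀ (h.s_ne i), ih]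
  have h1 := hb i
  simp only [mul_comm (b _)] at h1
  rw [hsum, h1, zpow_zero]

/-- Factor the generic point as `c' z` with both factors over the function field. The slice vector
`c'` takes `dim L - dim W` generators, where `W` is the radical. With `u = c' / c` in `W`, the
factor `z = s^A / u` satisfies all integer relations orthogonal to `R`, so at most `r'` monomials
generate it. -/
theorem exists_generators (h : IsGenericHorn A L s c) {R : Submodule ℂ (Fin N → ℂ)}
    (hR : ∀ u ∈ pairingKer c (scalarExt F (orth L)) (scalarExt F (rowSpan A)), ∀ e ∈ R,
      ∑ k, c k * u k * algebraMap ℂ F (e k) = 0)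
    (hW : pairingKer c (scalarExt F (orth L)) (scalarExt F (orth L)) ≤ scalarExt F R)
    (hAR : rowSpan A ≤ R) {r' : ℕ} {E : Fin r' → Fin N → ℤ} (hE : rowSpan E = R) :
    ∃ (ι : Type) (_ : Fintype ι) (y : ι → functionField A s c),
      IntermediateField.adjoin ℂ (Set.range y) = ⊤ ∧
      Fintype.card ι + Module.finrank F
        (pairingKer c (scalarExt F (orth L)) (scalarExt F (orth L))) ≤
          Module.finrank ℂ L + r' := by
  obtain ⟨ι, _, Y, c', hc', hc'0, hcard, hY⟩ := exists_slice L (conormalMeet A L s c)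
    inf_le_right h.exists_mem_conormalMeet_ne_zero
  have hc'F : ∀ k, (c' k : F) ≠ 0 := fun k h0 => hc'0 k (Subtype.ext h0)
  let u : Fin N → F := fun k => (c' k : F) / c k
  have hcu : c * u = fun k => (c' k : F) := funext fun k => mul_div_cancel₀ _ (h.c_ne k)
  have hu : u ∈ pairingKer c (scalarExt F (orth L)) (scalarExt F (orth L)) := by
    rw [← h.mem_conormalMeet_iff, hcu]
    exact map_mem_scalarExt hc'
  have hu0 : ∀ k, u k ≠ 0 := fun k => div_ne_zero (hc'F k) (h.c_ne k)
  let z : Fin N → (functionField A s c)ˣ := fun k =>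
    Units.mk0 (coordinate A s c k / c' k) (div_ne_zero (h.coordinate_ne_zero k) (hc'0 k))
  have hz : ∀ b : Fin N → ℤ, (∀ i, ∑ k, b k * E i k = 0) → ∏ k, z k ^ b k = 1 := by
    intro b hb
    have hbR : ∀ e ∈ R, ∑ k, (b k : ℂ) * e k = 0 := fun e he =>
      sum_mul_eq_zero_of_mem_rowSpan hb (hE ▸ he)
    have h1 := prod_zpow_eq_one_of_pow_mem hu0 (fun j => h.pow_mem_scalarExt hR hW hu j) hbR
    have h2 := h.prod_hornPoint_zpow (b := b) fun i => by
      have := hbR _ (hAR (Submodule.subset_span (Set.mem_range_self i)))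
      exact_mod_cast this
    apply Units.ext
    apply (algebraMap (functionField A s c) F).injective
    rw [Units.coe_prod, map_prod, Units.val_one, map_one]
    have h3 : ∀ k, algebraMap (functionField A s c) F ((z k ^ b k : (functionField A s c)ˣ)) =
        (∏ i, s i ^ A i k) ^ b k / u k ^ b k := by
      intro k
      rw [Units.val_zpow_eq_zpow_val, map_zpow₀, ← div_zpow]
      congr 1
      have := h.c_ne k
      have := hc'F k
      change hornPoint A s c k / (c' k : F) = _ / ((c' k : F) / c k)
      rw [hornPoint]
      field_simp
    rw [Finset.prod_congr rfl fun k _ => h3 k, Finset.prod_div_distrib, h1, h2, div_one]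
  obtain ⟨m, σ, hm, hσ⟩ := exists_torus_coordinates E z hz
  refine ⟨ι ⊕ Fin m, inferInstance, Sum.elim Y σ, ?_, ?_⟩
  · rw [eq_top_iff, ← adjoin_coordinate A s c, IntermediateField.adjoin_le_iff]
    rintro _ ⟨k, rfl⟩
    have h1 : coordinate A s c k = c' k * z k := by
      rw [Units.val_mk0, mul_div_cancel₀ _ (hc'0 k)]
    rw [SetLike.mem_coe, h1, Set.Sum.elim_range]
    exact mul_mem (IntermediateField.adjoin.mono ℂ _ _ Set.subset_union_left (hY k))
      (IntermediateField.adjoin.mono ℂ _ _ Set.subset_union_right (hσ k))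
  · rw [Fintype.card_sum, Fintype.card_fin, ← hcard, h.finrank_conormalMeet]
    omega

/-- The space of derivations has dimension `N` minus that of the conormal space, so `hcard` leaves
no room for a relation. -/
theorem exists_algebraicIndependent_of_generators (h : IsGenericHorn A L s c)
    {ι : Type} [Fintype ι] {y : ι → functionField A s c}
    (hy : IntermediateField.adjoin ℂ (Set.range y) = ⊤)
    (hcard : Fintype.card ι + Module.finrank F
      (pairingKer c (scalarExt F (orth L)) (scalarExt F (rowSpan A))) ≤ N) :
    AlgebraicIndependent ℂ y ∧ Fintype.card ι ≠ 0 := by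
  classical
  constructor
  · apply algebraicIndependent_of_card_le_finrank hy
    rw [← finrank_logDer (adjoin_coordinate A s c) h.coordinate_ne_zero]
    have := finrank_orth_add (logDer (coordinate A s c))
    rw [h.finrank_orth_logDer] at this
    omega
  -- With no generators every derivation would vanish, but homogeneity supplies the Euler derivation
  -- `D xₖ = xₖ`.
  · intro h0
    have hemp : IsEmpty ι := Fintype.card_eq_zero_iff.1 h0
    obtain ⟨D, hD⟩ := mem_logDer.1 (h.mem_logDer_of_pairing (R := rowSpan A)
      (fun u hu e he => hu.2 _ (map_mem_scalarExt he)) h.one_mem)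
    have hD0 : D = 0 := by
      refine derivation_eq_of_adjoin_eq_top hy ?_
      rintro _ ⟨i, rfl⟩
      exact hemp.elim i
    have hN : 0 < N := by
      have h1 := finrank_orth_add L
      have h2 := h.finrank_orth
      omega
    have h1 := hD ⟨0, hN⟩
    simp [hD0] at h1

/-- The function field of the image is purely transcendental. -/
theorem exists_purely_transcendental (h : IsGenericHorn A L s c) :
    ∃ (d : ℕ) (y : Fin (d + 1) → F), AlgebraicIndependent ℂ y ∧
      IntermediateField.adjoin ℂ (Set.range y) = functionField A s c := by
  classical
  set P := scalarExt F (orth L) with hP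
  set Q := scalarExt F (rowSpan A) with hQ
  have hQP : Q ≤ P := scalarExt_mono h.row_le
  suffices H : ∃ (ι : Type) (_ : Fintype ι) (y : ι → functionField A s c),
      IntermediateField.adjoin ℂ (Set.range y) = ⊤ ∧
      Fintype.card ι + Module.finrank F (pairingKer c P Q) ≤ N by
    obtain ⟨ι, _, y, hy, hcard⟩ := H
    obtain ⟨hind, hne⟩ := h.exists_algebraicIndependent_of_generators hy hcard
    obtain ⟨d, hd⟩ := Nat.exists_eq_succ_of_ne_zero hne
    let e : Fin (d + 1) ≃ ι := (Fintype.equivFinOfCardEq hd).symm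
    refine ⟨d, fun i => (y (e i) : F), ?_, ?_⟩
    · exact (hind.comp e e.injective).map' (f := (functionField A s c).val)
        (functionField A s c).val.injective
    · have h1 := congrArg IntermediateField.lift hy
      rw [IntermediateField.lift_adjoin, IntermediateField.lift_top, ← Set.range_comp] at h1
      refine Eq.trans ?_ h1
      rw [← e.surjective.range_comp (Subtype.val ∘ y)]
      rfl
  have hVW : pairingKer c Q P ≤ pairingKer c P P := fun u hu => ⟨hQP hu.1, hu.2⟩
  have hWU : pairingKer c P P ≤ pairingKer c P Q := fun u hu =>
    ⟨hu.1, fun e he => hu.2 e (hQP he)⟩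
  -- With `dim P = dim Q + 1` this gives `dim U = dim V + 1` for the outer terms of `V ⊆ W ⊆ U`, so
  -- `W` equals one of them.
  have hdim := finrank_pairingKer c P Q
  have hdimP : Module.finrank F P = r + 1 := by rw [hP, finrank_scalarExt, h.finrank_orth]
  have hdimQ : Module.finrank F Q = r := by rw [hQ, finrank_scalarExt, h.finrank_row]
  have hL := finrank_orth_add L
  rw [h.finrank_orth] at hL
  have hle1 := Submodule.finrank_mono hVW
  have hle2 := Submodule.finrank_mono hWU
  by_cases hcase : Module.finrank F (pairingKer c P P) = Module.finrank F (pairingKer c Q P)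
  · have hV : pairingKer c Q P = pairingKer c P P :=
      Submodule.eq_of_le_of_finrank_eq hVW hcase.symm
    -- Here `W = V` lies in `Q`; the count is `(N - r - 1) - dim W + r = N - dim U`.
    obtain ⟨ι, i1, y, hy, hcard⟩ := h.exists_generators (R := rowSpan A) (E := A)
      (fun u hu e he => hu.2 _ (map_mem_scalarExt he)) (fun u hu => (hV.ge hu).1) le_rfl rfl
    rw [← hP] at hcard
    exact ⟨ι, i1, y, hy, by omega⟩
  · have hU : pairingKer c P P = pairingKer c P Q :=
      Submodule.eq_of_le_of_finrank_eq hWU (by omega)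
    have hR : ∀ u ∈ pairingKer c P Q, ∀ e ∈ orth L, ∑ k, c k * u k * algebraMap ℂ F (e k) = 0 :=
      fun u hu e he => (hU.ge hu).2 _ (map_mem_scalarExt he)
    have hW : pairingKer c P P ≤ scalarExt F (orth L) := fun u hu => hu.1
    -- Here `W = U` and `R = orth L`, which must be shown to be spanned by integer vectors. It has
    -- one dimension more than the row span, so one further integer vector suffices: as `u` is a
    -- combination of its level-set indicators, one of these lies outside `rowSpan A`.
    obtain ⟨u, hu, huQ⟩ : ∃ u ∈ pairingKer c P P, u ∉ Q := by
      by_contra! hcon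
      have : pairingKer c P P ≤ pairingKer c Q P := fun u hu => ⟨hcon u hu, hu.2⟩
      exact hcase (le_antisymm (Submodule.finrank_mono this) hle1)
    have hind := fun a => indicator_mem_of_pow_mem
      (fun j => h.pow_mem_scalarExt hR hW hu j) a
    obtain ⟨a, ha⟩ : ∃ a, (fun k => if u k = a then (1 : ℂ) else 0) ∉ rowSpan A := by
      by_contra! hcon
      apply huQ
      have h1 : u = ∑ a ∈ Finset.univ.image u,
          a • fun k => algebraMap ℂ F (if u k = a then (1 : ℂ) else 0) := by
        funext k
        rw [Finset.sum_apply, Finset.sum_eq_single (u k)]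
        · simp
        · intro a _ ha
          simp [Ne.symm ha]
        · intro hk
          exact absurd (Finset.mem_image_of_mem u (Finset.mem_univ k)) hk
      rw [h1]
      exact Submodule.sum_mem _ fun a _ => Submodule.smul_mem _ _
        (map_mem_scalarExt (v := fun k => if u k = a then (1 : ℂ) else 0) (hcon a))
    let E : Fin (r + 1) → Fin N → ℤ := Fin.snoc A fun k => if u k = a then 1 else 0
    have hEle : rowSpan E ≤ orth L := by
      apply Submodule.span_le.2
      rintro _ ⟨i, rfl⟩
      induction i using Fin.lastCases with
      | last =>
        have := hind a
        simpa [E] using this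
      | cast i =>
        simpa [E] using h.row_le (Submodule.subset_span (Set.mem_range_self i))
    have hAE : rowSpan A < rowSpan E := by
      refine lt_of_le_of_ne (Submodule.span_le.2 ?_) ?_
      · rintro _ ⟨i, rfl⟩
        refine Submodule.subset_span ⟨i.castSucc, ?_⟩
        simp [E]
      · intro heq
        apply ha
        rw [heq]
        refine Submodule.subset_span ⟨Fin.last r, ?_⟩
        simp [E]
    have hE : rowSpan E = orth L := by
      apply Submodule.eq_of_le_of_finrank_le hEle
      have := Submodule.finrank_lt_finrank_of_lt hAE
      rw [h.finrank_row] at this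
      rw [h.finrank_orth]
      omega
    obtain ⟨ι, i1, y, hy, hcard⟩ := h.exists_generators hR hW h.row_le hE
    rw [← hP] at hcard
    exact ⟨ι, i1, y, hy, by omega⟩

end IsGenericHorn

end Cuspidal

end

/-! ### The universal generic point of a torus times a linear space -/

noncomputable section

namespace Cuspidal

theorem expA_eq_prod {n N : ℕ} (A : Matrix (Fin (n + 1)) (Fin N) ℤ) (ω : Fin (n + 1) → ℂ)
    (k : Fin N) : expA A ω k = ∏ i, Complex.exp (ω i) ^ A i k := by
  rw [expA, Complex.exp_sum]
  refine Finset.prod_congr rfl fun i _ => ?_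
  rw [mul_comm, Complex.exp_int_mul]

theorem prod_pow_toNat_div {G : Type} [Field G] {r M : ℕ} {x : Fin r → G} (hx : ∀ i, x i ≠ 0)
    {a : Fin r → ℤ} (ha : ∀ i, 0 ≤ a i + M) :
    (∏ i, x i ^ (a i + M).toNat) / (∏ i, x i) ^ M = ∏ i, x i ^ a i := by
  rw [← Finset.prod_pow, ← Finset.prod_div_distrib]
  refine Finset.prod_congr rfl fun i _ => ?_
  rw [← zpow_natCast, Int.toNat_of_nonneg (ha i), zpow_add₀ (hx i), zpow_natCast,
    mul_div_cancel_right₀ _ (pow_ne_zero _ (hx i))]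

theorem exists_coeff_of_mem_scalarExt {F : Type} [Field F] [Algebra ℂ F] {N q : ℕ}
    {L : Submodule ℂ (Fin N → ℂ)} (v : Module.Basis (Fin q) ℂ L) {τ : Fin N → F}
    (hτ : τ ∈ scalarExt F L) :
    ∃ θ : Fin q → F, ∀ k, τ k = ∑ j, θ j * algebraMap ℂ F ((v j : Fin N → ℂ) k) := by
  induction hτ using Submodule.span_induction with
  | mem τ hτ =>
    obtain ⟨w, hw, rfl⟩ := hτ
    refine ⟨fun j => algebraMap ℂ F (v.repr ⟨w, hw⟩ j), fun k => ?_⟩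
    have h1 := congrArg (fun z : L => (z : Fin N → ℂ) k) (v.sum_repr ⟨w, hw⟩)
    simp only [AddSubmonoidClass.coe_finsetSum, Finset.sum_apply, Submodule.coe_smul,
      Pi.smul_apply, smul_eq_mul] at h1
    simp only [← map_mul, ← map_sum, h1]
  | zero => exact ⟨0, fun k => by simp⟩
  | add a b _ _ ha hb =>
    obtain ⟨θ, hθ⟩ := ha
    obtain ⟨θ', hθ'⟩ := hb
    exact ⟨θ + θ', fun k => by simp [hθ, hθ', add_mul, Finset.sum_add_distrib]⟩
  | smul t a _ ha =>
    obtain ⟨θ, hθ⟩ := ha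
    exact ⟨t • θ, fun k => by simp [hθ, mul_assoc, Finset.mul_sum]⟩

section Universal

variable (r q : ℕ)

/-- The field of rational functions in `r + q` variables. -/
abbrev UniversalField : Type := FractionRing (MvPolynomial (Fin r ⊕ Fin q) ℂ)

theorem algebraicIndependent_universal :
    AlgebraicIndependent ℂ (fun i : Fin r ⊕ Fin q =>
      algebraMap (MvPolynomial (Fin r ⊕ Fin q) ℂ) (UniversalField r q) (X i)) :=
  (algebraicIndependent_X (Fin r ⊕ Fin q) ℂ).map'
    (f := Algebra.algHom ℂ (MvPolynomial (Fin r ⊕ Fin q) ℂ) (UniversalField r q))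
    (IsFractionRing.injective _ _)

theorem aeval_universal (p : MvPolynomial (Fin r ⊕ Fin q) ℂ) :
    aeval (fun i : Fin r ⊕ Fin q =>
      algebraMap (MvPolynomial (Fin r ⊕ Fin q) ℂ) (UniversalField r q) (X i)) p =
    algebraMap _ (UniversalField r q) p := by
  have h : aeval (fun i : Fin r ⊕ Fin q =>
      algebraMap (MvPolynomial (Fin r ⊕ Fin q) ℂ) (UniversalField r q) (X i)) =
      Algebra.algHom ℂ (MvPolynomial (Fin r ⊕ Fin q) ℂ) (UniversalField r q) := by
    ext i
    rw [aeval_X]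
    rfl
  rw [h]
  rfl

variable {r q}

/-- Derivations of the polynomial ring take arbitrary values on the variables and extend to the
localization, which is formally smooth. -/
theorem exists_derivation_universal (f : Fin r ⊕ Fin q → UniversalField r q) :
    ∃ D : Derivation ℂ (UniversalField r q) (UniversalField r q), ∀ i,
      D (algebraMap (MvPolynomial (Fin r ⊕ Fin q) ℂ) _ (X i)) = f i := by
  have : Algebra.FormallySmooth (MvPolynomial (Fin r ⊕ Fin q) ℂ) (UniversalField r q) :=
    .of_isLocalization (nonZeroDivisors _)
  obtain ⟨D, hD⟩ := exists_derivation_extension (mkDerivation ℂ f)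
  exact ⟨D, fun i => by rw [hD, mkDerivation_X]⟩

/-- The extension over `K` is essentially of finite type in characteristic zero, hence formally
smooth. -/
theorem extend_derivation_universal (K : IntermediateField ℂ (UniversalField r q))
    (D : Derivation ℂ K (UniversalField r q)) :
    ∃ D' : Derivation ℂ (UniversalField r q) (UniversalField r q), ∀ a : K, D' a = D a := by
  have : Algebra.EssFiniteType (MvPolynomial (Fin r ⊕ Fin q) ℂ) (UniversalField r q) :=
    .of_isLocalization _ (nonZeroDivisors _)
  have : Algebra.EssFiniteType ℂ (UniversalField r q) :=
    .comp ℂ (MvPolynomial (Fin r ⊕ Fin q) ℂ) _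
  have : Algebra.EssFiniteType K (UniversalField r q) := .of_comp ℂ K _
  have : CharZero K := charZero_of_injective_algebraMap (algebraMap ℂ K).injective
  exact exists_derivation_extension D

/-- The generic linear combination of the `k`-th coordinates of a basis. -/
def genericCoord {N : ℕ} {L : Submodule ℂ (Fin N → ℂ)} (v : Module.Basis (Fin q) ℂ L) (r : ℕ)
    (k : Fin N) : MvPolynomial (Fin r ⊕ Fin q) ℂ :=
  ∑ j, X (Sum.inr j) * C ((v j : Fin N → ℂ) k)

theorem eval_genericCoord {N : ℕ} {L : Submodule ℂ (Fin N → ℂ)} (v : Module.Basis (Fin q) ℂ L)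
    (k : Fin N) (τ : Fin r ⊕ Fin q → ℂ) :
    eval τ (genericCoord v r k) = (∑ j, τ (Sum.inr j) • v j : L).1 k := by
  simp [genericCoord]

theorem eval_genericCoord_repr {N : ℕ} {L : Submodule ℂ (Fin N → ℂ)}
    (v : Module.Basis (Fin q) ℂ L) (k : Fin N) (σ : Fin r → ℂ) (w : L) :
    eval (Sum.elim σ (v.repr w)) (genericCoord v r k) = (w : Fin N → ℂ) k := by
  rw [eval_genericCoord]
  simp only [Sum.elim_inr, v.sum_repr]

theorem genericCoord_ne_zero {N : ℕ} {L : Submodule ℂ (Fin N → ℂ)}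
    (v : Module.Basis (Fin q) ℂ L) {k : Fin N} (hk : ∃ w ∈ L, w k ≠ 0) :
    genericCoord v r k ≠ 0 := by
  obtain ⟨w, hw, hwk⟩ := hk
  intro h0
  have := eval_genericCoord_repr v k (0 : Fin r → ℂ) ⟨w, hw⟩
  rw [h0, map_zero] at this
  exact hwk this.symm

theorem exists_isGenericHorn {N : ℕ} {A : Fin r → Fin N → ℤ} {L : Submodule ℂ (Fin N → ℂ)}
    (v : Module.Basis (Fin q) ℂ L) (hL : ∀ k, ∃ w ∈ L, w k ≠ 0)
    (row_le : rowSpan A ≤ orth L) (one_mem : (fun _ => 1) ∈ rowSpan A)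
    (finrank_row : Module.finrank ℂ (rowSpan A) = r)
    (finrank_orth : Module.finrank ℂ (orth L) = r + 1) :
    IsGenericHorn A L
      (fun i => algebraMap (MvPolynomial (Fin r ⊕ Fin q) ℂ) (UniversalField r q) (X (Sum.inl i)))
      (fun k => algebraMap _ (UniversalField r q) (genericCoord v r k)) where
  s_ne i := (map_ne_zero_iff _ (IsFractionRing.injective _ _)).2 (X_ne_zero _)
  c_ne k := (map_ne_zero_iff _ (IsFractionRing.injective _ _)).2 (genericCoord_ne_zero v (hL k))
  c_mem := by
    have h : (fun k => algebraMap _ (UniversalField r q) (genericCoord v r k)) =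
        ∑ j, algebraMap (MvPolynomial (Fin r ⊕ Fin q) ℂ) (UniversalField r q) (X (Sum.inr j)) •
          fun k => algebraMap ℂ (UniversalField r q) ((v j : Fin N → ℂ) k) := by
      funext k
      simp only [genericCoord, map_sum, map_mul, Finset.sum_apply, Pi.smul_apply, smul_eq_mul]
      rfl
    rw [h]
    exact Submodule.sum_mem _ fun j _ => Submodule.smul_mem _ _ (map_mem_scalarExt (v j).2)
  exists_derivation := by
    intro τ hτ δ
    obtain ⟨θ, hθ⟩ := exists_coeff_of_mem_scalarExt v hτ
    obtain ⟨D, hD⟩ := exists_derivation_universal (Sum.elim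
      (fun i => δ i * algebraMap (MvPolynomial (Fin r ⊕ Fin q) ℂ) _ (X (Sum.inl i))) θ)
    refine ⟨D, fun k => ?_, fun i => hD (Sum.inl i)⟩
    rw [hθ, genericCoord, map_sum, map_sum]
    refine Finset.sum_congr rfl fun j _ => ?_
    have hC : ∀ a : ℂ, algebraMap (MvPolynomial (Fin r ⊕ Fin q) ℂ) (UniversalField r q) (C a) =
      algebraMap ℂ _ a := fun a => rfl
    rw [map_mul, hC, Derivation.leibniz, Derivation.map_algebraMap, hD]
    simp [mul_comm]
  extend := extend_derivation_universal
  row_le := row_le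
  one_mem := one_mem
  finrank_row := finrank_row
  finrank_orth := finrank_orth

end Universal

/-- The generic point of the image of the torus times a linear space. -/
theorem vanishingIdeal_hornImage {n N q : ℕ} (A : Matrix (Fin (n + 1)) (Fin N) ℤ)
    {L : Submodule ℂ (Fin N → ℂ)} (v : Module.Basis (Fin q) ℂ L) (hL : ∀ k, ∃ w ∈ L, w k ≠ 0)
    {S : Set (Fin N → ℂ)}
    (hS : ∀ f, f ∈ S ↔ ∃ ω, ∃ w ∈ L, w ∈ torus N ∧ ∀ k, f k = expA A ω k * w k) :
    vanishingIdeal ℂ S = RingHom.ker (aeval (hornPoint A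
      (fun i => algebraMap (MvPolynomial (Fin (n + 1) ⊕ Fin q) ℂ) (UniversalField (n + 1) q)
        (X (Sum.inl i)))
      (fun k => algebraMap _ (UniversalField (n + 1) q) (genericCoord v (n + 1) k))) :
        MvPolynomial (Fin N) ℂ →ₐ[ℂ] UniversalField (n + 1) q) := by
  -- Shifting all exponents by `M` turns the Laurent monomials into polynomials over the common
  -- denominator `mon ^ M`.
  obtain ⟨M, hM⟩ : ∃ M : ℕ, ∀ i k, 0 ≤ A i k + M := by
    refine ⟨∑ i, ∑ k, (A i k).natAbs, fun i k => ?_⟩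
    have h1 : (A i k).natAbs ≤ ∑ i, ∑ k, (A i k).natAbs :=
      (Finset.single_le_sum (f := fun k => (A i k).natAbs) (fun _ _ => Nat.zero_le _)
        (Finset.mem_univ k)).trans
      (Finset.single_le_sum (f := fun i => ∑ k, (A i k).natAbs) (fun _ _ => Nat.zero_le _)
        (Finset.mem_univ i))
    omega
  let mon : MvPolynomial (Fin (n + 1) ⊕ Fin q) ℂ := ∏ i, X (Sum.inl i)
  have hmon : mon ≠ 0 := Finset.prod_ne_zero_iff.2 fun i _ => X_ne_zero _
  -- The factor `mon` in `h` is needed since `M` may be `0`: the torus parameters must be nonzero to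
  -- be exponentials. The other factor keeps the point of `L` in the torus.
  refine vanishingIdeal_of_parametrization (algebraicIndependent_universal (n + 1) q)
    (a := fun k => genericCoord v (n + 1) k * ∏ i, X (Sum.inl i) ^ (A i k + M).toNat)
    (b := mon ^ M) (h := mon * ∏ k, genericCoord v (n + 1) k) (pow_ne_zero _ hmon)
    (mul_ne_zero hmon (Finset.prod_ne_zero_iff.2 fun k _ => genericCoord_ne_zero v (hL k)))
    (fun k => ?_) (fun f => ?_)
  · simp only [hornPoint]
    rw [aeval_universal, aeval_universal, ← prod_pow_toNat_div _ (fun i => hM i k)]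
    · simp only [mon, map_mul, map_prod, map_pow, mul_div_assoc]
    · exact fun i => (map_ne_zero_iff _ (IsFractionRing.injective _ _)).2 (X_ne_zero _)
  · have heval : ∀ (τ : Fin (n + 1) ⊕ Fin q → ℂ), (∀ i, τ (Sum.inl i) ≠ 0) → ∀ k,
        eval τ (genericCoord v (n + 1) k * ∏ i, X (Sum.inl i) ^ (A i k + M).toNat) /
          eval τ (mon ^ M) = eval τ (genericCoord v (n + 1) k) * ∏ i, τ (Sum.inl i) ^ A i k := by
      intro τ hτ k
      rw [← prod_pow_toNat_div hτ (fun i => hM i k)]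
      simp only [mon, map_mul, map_prod, map_pow, mul_div_assoc, eval_X]
    rw [hS]
    constructor
    · rintro ⟨ω, w, hw, hwt, hf⟩
      have hmone : eval (Sum.elim (fun i => Complex.exp (ω i)) (v.repr ⟨w, hw⟩)) mon ≠ 0 := by
        simp only [mon, map_prod, eval_X, Sum.elim_inl]
        exact Finset.prod_ne_zero_iff.2 fun i _ => Complex.exp_ne_zero _
      refine ⟨Sum.elim (fun i => Complex.exp (ω i)) (v.repr ⟨w, hw⟩), ?_, ?_, fun k => ?_⟩
      · rw [map_pow]
        exact pow_ne_zero _ hmone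
      · rw [map_mul, map_prod _ (genericCoord v (n + 1))]
        refine mul_ne_zero hmone (Finset.prod_ne_zero_iff.2 fun k _ => ?_)
        rw [eval_genericCoord_repr]
        exact hwt k
      · rw [heval _ (fun i => Complex.exp_ne_zero _), eval_genericCoord_repr, hf, expA_eq_prod,
          mul_comm]
        rfl
    · rintro ⟨τ, -, hτ, hf⟩
      rw [map_mul, map_prod _ (genericCoord v (n + 1))] at hτ
      have h1 := left_ne_zero_of_mul hτ
      have h2 := Finset.prod_ne_zero_iff.1 (right_ne_zero_of_mul hτ)
      simp only [mon, map_prod, eval_X] at h1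
      have h3 : ∀ i, τ (Sum.inl i) ≠ 0 := fun i => Finset.prod_ne_zero_iff.1 h1 i (Finset.mem_univ i)
      refine ⟨fun i => Complex.log (τ (Sum.inl i)), _, (∑ j, τ (Sum.inr j) • v j : L).2,
        fun k => ?_, fun k => ?_⟩
      · rw [← eval_genericCoord (r := n + 1)]
        exact h2 k (Finset.mem_univ k)
      · rw [hf, heval τ h3, expA_eq_prod, ← eval_genericCoord (r := n + 1), mul_comm]
        congr 1
        exact Finset.prod_congr rfl fun i _ => by rw [Complex.exp_log (h3 i)]

end Cuspidal

end

noncomputable section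

namespace Cuspidal

/-! ### Singular points of exponential sums -/

theorem hasFDerivAt_expA {n N : ℕ} (A : Matrix (Fin (n + 1)) (Fin N) ℤ) (w : Fin (n + 1) → ℂ)
    (k : Fin N) : HasFDerivAt (fun ω => expA A ω k)
      (expA A w k • ∑ i, (A i k : ℂ) •
        (ContinuousLinearMap.proj i : (Fin (n + 1) → ℂ) →L[ℂ] ℂ)) w := by
  have h : HasFDerivAt (fun ω : Fin (n + 1) → ℂ => ∑ i, ω i * (A i k : ℂ))
      (∑ i, (A i k : ℂ) • (ContinuousLinearMap.proj i : (Fin (n + 1) → ℂ) →L[ℂ] ℂ)) w :=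
    HasFDerivAt.fun_sum fun i _ =>
      (ContinuousLinearMap.proj i : (Fin (n + 1) → ℂ) →L[ℂ] ℂ).hasFDerivAt.mul_const _
  exact h.cexp

/-- The partial derivatives are the equations on the right; as the top row is all ones, the one for
`i = 0` is also `f = 0`. -/
theorem isSingularPoint_iff {n N : ℕ} {A : Matrix (Fin (n + 1)) (Fin N) ℤ}
    (hA : ∀ k, A 0 k = 1) (c : Fin N → ℂ) (w : Fin (n + 1) → ℂ) :
    IsSingularPoint A c w ↔ ∀ i, ∑ k, c k * expA A w k * (A i k : ℂ) = 0 := by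
  have h : HasFDerivAt (expSum A c) (∑ k, c k • (expA A w k • ∑ i, (A i k : ℂ) •
      (ContinuousLinearMap.proj i : (Fin (n + 1) → ℂ) →L[ℂ] ℂ))) w :=
    HasFDerivAt.fun_sum fun k _ => (hasFDerivAt_expA A w k).const_mul _
  have happ : ∀ v, fderiv ℂ (expSum A c) w v =
      ∑ i, v i * ∑ k, c k * expA A w k * (A i k : ℂ) := by
    intro v
    rw [h.fderiv]
    simp only [_root_.sum_apply, _root_.smul_apply, smul_eq_mul,
      ContinuousLinearMap.proj_apply, Finset.mul_sum]
    rw [Finset.sum_comm]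
    exact Finset.sum_congr rfl fun i _ => Finset.sum_congr rfl fun k _ => by ring
  constructor
  · rintro ⟨-, h2⟩ i
    have := happ (Pi.single i 1)
    rw [h2] at this
    simpa [Pi.single_apply] using this.symm
  · intro hi
    refine ⟨?_, ?_⟩
    · simpa [hA, expSum] using hi 0
    · ext v
      rw [happ]
      simp [hi]

/-! ### The discriminant of a simplex with an interior point -/

/-- The configuration consisting of the origin, the unit vectors `e₁, …, e_d` and
`-e₁ - ⋯ - e_d`. -/
def starConfig (d : ℕ) : Matrix (Fin (d + 1)) (Fin (d + 2)) ℤ :=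
  fun i k => Fin.cases 1
    (fun j => if k = j.succ.castSucc then 1 else if k = Fin.last (d + 1) then -1 else 0) i

theorem starConfig_zero (d : ℕ) (k : Fin (d + 2)) : starConfig d 0 k = 1 :=
  rfl

theorem starConfig_succ_zero (d : ℕ) (j : Fin d) :
    starConfig d j.succ (Fin.castSucc 0) = 0 := by
  have h1 : (Fin.castSucc (0 : Fin (d + 1))) ≠ j.succ.castSucc := fun h =>
    (Fin.succ_ne_zero j) (Fin.castSucc_injective _ h).symm
  have h2 : (Fin.castSucc (0 : Fin (d + 1))) ≠ Fin.last (d + 1) := (Fin.castSucc_lt_last _).ne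
  simp only [starConfig, Fin.cases_succ, if_neg h1, if_neg h2]

theorem starConfig_succ_succ (d : ℕ) (j i : Fin d) :
    starConfig d j.succ i.succ.castSucc = if i = j then 1 else 0 := by
  have h2 : (i.succ.castSucc : Fin (d + 2)) ≠ Fin.last (d + 1) := (Fin.castSucc_lt_last _).ne
  simp only [starConfig, Fin.cases_succ, if_neg h2, Fin.castSucc_inj, Fin.succ_inj]

theorem starConfig_succ_last (d : ℕ) (j : Fin d) :
    starConfig d j.succ (Fin.last (d + 1)) = -1 := by
  have h2 : Fin.last (d + 1) ≠ j.succ.castSucc := (Fin.castSucc_lt_last _).ne'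
  simp only [starConfig, Fin.cases_succ, if_neg h2, if_true]

theorem isAlgConfig_starConfig (d : ℕ) : IsAlgConfig (starConfig d) where
  top_row := starConfig_zero d
  full_rank := by
    have h : LinearIndependent ℂ ((starConfig d).map (Int.cast : ℤ → ℂ)).row := by
      rw [Fintype.linearIndependent_iff]
      intro g hg
      have hcol : ∀ k, g 0 + ∑ j : Fin d, g j.succ * (starConfig d j.succ k : ℂ) = 0 := by
        intro k
        have := congrFun hg k
        simpa [Finset.sum_apply, Fin.sum_univ_succ, starConfig_zero] using this
      have h0 : g 0 = 0 := by
        have := hcol (Fin.castSucc 0)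
        simpa only [starConfig_succ_zero, Int.cast_zero, mul_zero, Finset.sum_const_zero,
          add_zero] using this
      intro i
      induction i using Fin.cases with
      | zero => exact h0
      | succ i =>
        have := hcol i.succ.castSucc
        rw [h0, zero_add, Finset.sum_congr rfl fun j _ => by rw [starConfig_succ_succ]] at this
        simpa using this
    rw [h.rank_matrix, Fintype.card_fin]

theorem expA_starConfig_zero (d : ℕ) (w : Fin (d + 1) → ℂ) :
    expA (starConfig d) w (Fin.castSucc 0) = Complex.exp (w 0) := by
  rw [expA_eq_prod, Fin.prod_univ_succ]
  simp only [starConfig_zero, starConfig_succ_zero, zpow_one, zpow_zero, Finset.prod_const_one,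
    mul_one]

theorem expA_starConfig_succ (d : ℕ) (w : Fin (d + 1) → ℂ) (i : Fin d) :
    expA (starConfig d) w i.succ.castSucc = Complex.exp (w 0) * Complex.exp (w i.succ) := by
  rw [expA_eq_prod, Fin.prod_univ_succ, Finset.prod_eq_single i]
  · rw [starConfig_zero, starConfig_succ_succ, if_pos rfl, zpow_one, zpow_one]
  · intro j _ hj
    rw [starConfig_succ_succ, if_neg (Ne.symm hj), zpow_zero]
  · simp

theorem expA_starConfig_last (d : ℕ) (w : Fin (d + 1) → ℂ) :
    expA (starConfig d) w (Fin.last (d + 1)) =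
      Complex.exp (w 0) / ∏ i : Fin d, Complex.exp (w i.succ) := by
  rw [expA_eq_prod, Fin.prod_univ_succ]
  simp only [starConfig_zero, starConfig_succ_last, zpow_one, zpow_neg, Finset.prod_inv_distrib,
    div_eq_mul_inv]

theorem isSingularPoint_starConfig_iff (d : ℕ) (c : Fin (d + 2) → ℂ) (w : Fin (d + 1) → ℂ) :
    IsSingularPoint (starConfig d) c w ↔
      (∀ i : Fin d, c i.succ.castSucc * expA (starConfig d) w i.succ.castSucc =
        c (Fin.last (d + 1)) * expA (starConfig d) w (Fin.last (d + 1))) ∧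
      c (Fin.castSucc 0) * expA (starConfig d) w (Fin.castSucc 0) =
        -((d + 1) * (c (Fin.last (d + 1)) * expA (starConfig d) w (Fin.last (d + 1)))) := by
  rw [isSingularPoint_iff (starConfig_zero d)]
  have hsum : ∀ i, ∑ k, c k * expA (starConfig d) w k * (starConfig d i k : ℂ) =
      c (Fin.castSucc 0) * expA (starConfig d) w (Fin.castSucc 0) *
          (starConfig d i (Fin.castSucc 0) : ℂ) +
        ∑ j : Fin d, c j.succ.castSucc * expA (starConfig d) w j.succ.castSucc *
          (starConfig d i j.succ.castSucc : ℂ) +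
        c (Fin.last (d + 1)) * expA (starConfig d) w (Fin.last (d + 1)) *
          (starConfig d i (Fin.last (d + 1)) : ℂ) := by
    intro i
    rw [Fin.sum_univ_castSucc, Fin.sum_univ_succ]
  have hsucc : ∀ i : Fin d, ∑ k, c k * expA (starConfig d) w k * (starConfig d i.succ k : ℂ) =
      c i.succ.castSucc * expA (starConfig d) w i.succ.castSucc -
        c (Fin.last (d + 1)) * expA (starConfig d) w (Fin.last (d + 1)) := by
    intro i
    rw [hsum]
    simp only [starConfig_succ_zero, starConfig_succ_succ, starConfig_succ_last]
    rw [Finset.sum_eq_single i]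
    · simp [sub_eq_add_neg]
    · intro j _ hj
      simp [hj]
    · simp
  have hzero := hsum 0
  simp only [starConfig_zero, Int.cast_one, mul_one] at hzero
  constructor
  · intro h
    have h1 : ∀ i : Fin d, c i.succ.castSucc * expA (starConfig d) w i.succ.castSucc =
        c (Fin.last (d + 1)) * expA (starConfig d) w (Fin.last (d + 1)) := fun i =>
      sub_eq_zero.1 ((hsucc i).symm.trans (h i.succ))
    refine ⟨h1, ?_⟩
    have h0 := h 0
    simp only [starConfig_zero, Int.cast_one, mul_one] at h0
    rw [h0, Finset.sum_congr rfl fun i _ => h1 i, Finset.sum_const, Finset.card_univ,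
      Fintype.card_fin, nsmul_eq_mul] at hzero
    linear_combination -hzero
  · rintro ⟨h1, h2⟩ i
    induction i using Fin.cases with
    | zero =>
      simp only [starConfig_zero, Int.cast_one, mul_one]
      rw [hzero, Finset.sum_congr rfl fun i _ => h1 i, Finset.sum_const, Finset.card_univ,
        Fintype.card_fin, nsmul_eq_mul, h2]
      ring
    | succ i => rw [hsucc, h1, sub_self]

/-- At a singular point the `d + 1` vertex terms of the sum share a value and the interior term is
`-(d + 1)` times it; multiplying the vertex terms eliminates `w`. -/
theorem exists_isSingularPoint_starConfig_iff {d : ℕ} {c : Fin (d + 2) → ℂ}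
    (hc : c ∈ torus (d + 2)) :
    (∃ w, IsSingularPoint (starConfig d) c w) ↔
      c (Fin.last (d + 1)) * ((d + 1) ^ (d + 1) * ∏ i : Fin d, c i.succ.castSucc) =
        (-c (Fin.castSucc 0)) ^ (d + 1) := by
  have hd : (d + 1 : ℂ) ≠ 0 := by exact_mod_cast d.succ_ne_zero
  constructor
  · rintro ⟨w, hw⟩
    rw [isSingularPoint_starConfig_iff] at hw
    obtain ⟨h1, h2⟩ := hw
    rw [expA_starConfig_zero, expA_starConfig_last] at h2
    simp only [expA_starConfig_succ, expA_starConfig_last] at h1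
    set x := Complex.exp (w 0) with hx
    have hx0 : x ≠ 0 := Complex.exp_ne_zero _
    set p := ∏ i : Fin d, Complex.exp (w i.succ) with hp
    have hp0 : p ≠ 0 := Finset.prod_ne_zero_iff.2 fun i _ => Complex.exp_ne_zero _
    have h3 : (∏ i : Fin d, c i.succ.castSucc) * (x ^ d * p) =
        (c (Fin.last (d + 1)) * (x / p)) ^ d := by
      have : ∏ i : Fin d, (c i.succ.castSucc * (x * Complex.exp (w i.succ))) =
          ∏ i : Fin d, (c (Fin.last (d + 1)) * (x / p)) := Finset.prod_congr rfl fun i _ => h1 i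
      rw [Finset.prod_mul_distrib, Finset.prod_mul_distrib, Finset.prod_const, Finset.prod_const,
        Finset.card_univ, Fintype.card_fin] at this
      exact this
    have h4 : (-c (Fin.castSucc 0)) * x = (d + 1) * (c (Fin.last (d + 1)) * (x / p)) := by
      linear_combination -h2
    have h5 := congrArg (· ^ (d + 1)) h4
    simp only [mul_pow _ _ (d + 1)] at h5
    apply mul_right_cancel₀ (pow_ne_zero (d + 1) hx0)
    rw [h5, ← mul_pow, pow_succ (c _ * _), ← h3]
    field_simp
    ring
  · intro h
    -- The common value of the vertex terms, when `w 0` is normalized to `0`.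
    set lam := -c (Fin.castSucc 0) / (d + 1) with hlam
    have hlam0 : lam ≠ 0 := div_ne_zero (neg_ne_zero.2 (hc _)) hd
    let w : Fin (d + 1) → ℂ := Fin.cons 0 fun i => Complex.log (lam / c i.succ.castSucc)
    have hw0 : Complex.exp (w 0) = 1 := by simp [w]
    have hws : ∀ i : Fin d, Complex.exp (w i.succ) = lam / c i.succ.castSucc := by
      intro i
      simp only [w, Fin.cons_succ]
      exact Complex.exp_log (div_ne_zero hlam0 (hc _))
    have hlast : c (Fin.last (d + 1)) * expA (starConfig d) w (Fin.last (d + 1)) = lam := by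
      rw [expA_starConfig_last, hw0, Finset.prod_congr rfl fun i _ => hws i,
        Finset.prod_div_distrib, Finset.prod_const, Finset.card_univ, Fintype.card_fin,
        one_div_div, mul_div_assoc', div_eq_iff (pow_ne_zero _ hlam0), ← pow_succ', hlam, div_pow,
        eq_div_iff (pow_ne_zero _ hd), ← h]
      ring
    refine ⟨w, (isSingularPoint_starConfig_iff d c w).2 ⟨fun i => ?_, ?_⟩⟩
    · rw [hlast, expA_starConfig_succ, hw0, hws, one_mul, mul_div_cancel₀ _ (hc _)]
    · rw [hlast, expA_starConfig_zero, hw0, hlam]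
      field_simp

/-- The discriminant of the star configuration is rational. -/
theorem exists_generic_discriminant_starConfig {F : Type} [Field F] [Algebra ℂ F] {d : ℕ}
    {y : Fin (d + 1) → F} (hy : AlgebraicIndependent ℂ y) :
    ∃ η : Fin (d + 2) → F, (∀ k, η k ≠ 0) ∧ discriminant (starConfig d) = genericLocus η ∧
      IntermediateField.adjoin ℂ (Set.range η) = IntermediateField.adjoin ℂ (Set.range y) := by
  have hd : (d + 1 : ℂ) ≠ 0 := by exact_mod_cast d.succ_ne_zero
  have hy0 : ∀ i, y i ≠ 0 := fun i => hy.ne_zero i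
  let b : MvPolynomial (Fin (d + 1)) ℂ :=
    C ((d + 1 : ℂ) ^ (d + 1)) * ∏ i : Fin d, X (Fin.succ i)
  have hb : b ≠ 0 := mul_ne_zero ((by rw [Ne, C_eq_zero]; exact pow_ne_zero _ hd))
    (Finset.prod_ne_zero_iff.2 fun i _ => X_ne_zero _)
  have hby : aeval (R := ℂ) y b ≠ 0 := fun h0 =>
    hb ((injective_iff_map_eq_zero (aeval (R := ℂ) y)).1 hy b h0)
  -- The discriminant equation is linear in the last coefficient, so the others are free parameters
  -- and the last is a rational function of them.
  let a : Fin (d + 2) → MvPolynomial (Fin (d + 1)) ℂ :=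
    Fin.snoc (fun i => X i * b) ((-X 0) ^ (d + 1))
  let η : Fin (d + 2) → F := fun k => aeval y (a k) / aeval y b
  have hη1 : ∀ i : Fin (d + 1), η i.castSucc = y i := by
    intro i
    simp only [η, a, Fin.snoc_castSucc, map_mul, aeval_X]
    exact mul_div_cancel_right₀ _ hby
  have hη2 : η (Fin.last (d + 1)) = (-y 0) ^ (d + 1) / aeval y b := by
    simp [η, a]
  have hη0 : ∀ k, η k ≠ 0 := by
    intro k
    induction k using Fin.lastCases with
    | last => exact hη2 ▸ div_ne_zero (pow_ne_zero _ (neg_ne_zero.2 (hy0 0))) hby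
    | cast i => exact hη1 i ▸ hy0 i
  refine ⟨η, hη0, torusClosure_eq_genericLocus ?_, ?_⟩
  · refine vanishingIdeal_of_parametrization hy (a := a) (b := b) (h := ∏ i, X i) hb
      (Finset.prod_ne_zero_iff.2 fun i _ => X_ne_zero _) (fun k => rfl) fun c => ?_
    have hbτ : ∀ τ : Fin (d + 1) → ℂ,
        eval τ b = (d + 1) ^ (d + 1) * ∏ i : Fin d, τ i.succ := by
      intro τ
      simp [b]
    have hX : ∀ τ : Fin (d + 1) → ℂ,
        eval τ (∏ i, X i : MvPolynomial (Fin (d + 1)) ℂ) = ∏ i, τ i := by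
      intro τ
      simp
    have ha1 : ∀ τ : Fin (d + 1) → ℂ, eval τ b ≠ 0 → ∀ i : Fin (d + 1),
        eval τ (a i.castSucc) / eval τ b = τ i := by
      intro τ hτ i
      simp only [a, Fin.snoc_castSucc, map_mul, eval_X]
      exact mul_div_cancel_right₀ _ hτ
    have ha2 : ∀ τ : Fin (d + 1) → ℂ, eval τ (a (Fin.last (d + 1))) = (-τ 0) ^ (d + 1) := by
      intro τ
      simp [a]
    constructor
    · rintro ⟨hc, hw⟩
      rw [exists_isSingularPoint_starConfig_iff hc] at hw
      have hb' : eval (fun i : Fin (d + 1) => c i.castSucc) b ≠ 0 := by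
        rw [hbτ]
        exact mul_ne_zero (pow_ne_zero _ hd) (Finset.prod_ne_zero_iff.2 fun i _ => hc _)
      refine ⟨fun i => c i.castSucc, hb', ?_, fun k => ?_⟩
      · rw [hX]
        exact Finset.prod_ne_zero_iff.2 fun i _ => hc _
      · induction k using Fin.lastCases with
        | last => rw [ha2, eq_div_iff hb', hbτ, hw]
        | cast i => rw [ha1 _ hb']
    · rintro ⟨τ, hτb, hτ, hcτ⟩
      rw [hX, Finset.prod_ne_zero_iff] at hτ
      have hc1 : ∀ i : Fin (d + 1), c i.castSucc = τ i := fun i => by rw [hcτ, ha1 _ hτb]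
      have hc2 : c (Fin.last (d + 1)) = (-τ 0) ^ (d + 1) / eval τ b := by rw [hcτ, ha2]
      have hc : c ∈ torus (d + 2) := by
        intro k
        induction k using Fin.lastCases with
        | last =>
          rw [hc2]
          exact div_ne_zero (pow_ne_zero _ (neg_ne_zero.2 (hτ 0 (Finset.mem_univ _)))) hτb
        | cast i =>
          rw [hc1]
          exact hτ i (Finset.mem_univ _)
      refine ⟨hc, (exists_isSingularPoint_starConfig_iff hc).2 ?_⟩
      simp only [hc1]
      rw [hc2, ← hbτ, div_mul_cancel₀ _ hτb]
  · apply le_antisymm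
    · rw [IntermediateField.adjoin_le_iff]
      rintro _ ⟨k, rfl⟩
      exact (IntermediateField.mem_adjoin_range_iff ℂ y _).2 ⟨a k, b, rfl⟩
    · rw [IntermediateField.adjoin_le_iff]
      rintro _ ⟨i, rfl⟩
      exact IntermediateField.subset_adjoin ℂ _ ⟨i.castSucc, hη1 i⟩

end Cuspidal

end

noncomputable section

namespace Cuspidal

/-! ### The Cauchy–Binet formula -/

theorem det_mul_eq_sum_functions {n N : ℕ} (P : Matrix (Fin n) (Fin N) ℂ)
    (Q : Matrix (Fin N) (Fin n) ℂ) :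
    (P * Q).det = ∑ f : Fin n → Fin N, (∏ i, P i (f i)) * (Q.submatrix f id).det := by
  have h : (P * Q : Matrix _ _ ℂ) = fun i => ∑ k, P i k • Q k := by
    funext i j
    simp [Matrix.mul_apply, Finset.sum_apply]
  have h1 := (Matrix.detRowAlternating (n := Fin n) (R := ℂ)).toMultilinearMap.map_sum
    (fun i k => P i k • Q k)
  have h2 : ∀ f : Fin n → Fin N, (Matrix.detRowAlternating (n := Fin n) (R := ℂ)).toMultilinearMap
      (fun i => P i (f i) • Q (f i)) = (∏ i, P i (f i)) * (Q.submatrix f id).det := fun f =>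
    (Matrix.detRowAlternating (n := Fin n) (R := ℂ)).toMultilinearMap.map_smul_univ
      (fun i => P i (f i)) (fun i => Q (f i))
  rw [h]
  exact h1.trans (Finset.sum_congr rfl fun f _ => h2 f)

/-- The Cauchy–Binet formula. -/
theorem det_mul_eq_sum_minors {n N : ℕ} (P : Matrix (Fin n) (Fin N) ℂ)
    (Q : Matrix (Fin N) (Fin n) ℂ) :
    (P * Q).det = ∑ σ : {σ : Finset (Fin N) // σ.card = n},
      (P.submatrix id (σ.1.orderEmbOfFin σ.2)).det *
        (Q.submatrix (σ.1.orderEmbOfFin σ.2) id).det := by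
  classical
  rw [det_mul_eq_sum_functions]
  have h1 : ∑ f : Fin n → Fin N, (∏ i, P i (f i)) * (Q.submatrix f id).det =
      ∑ f : Fin n → Fin N with Function.Injective f,
        (∏ i, P i (f i)) * (Q.submatrix f id).det := by
    symm
    apply Finset.sum_subset (Finset.subset_univ _)
    intro f _ hf
    have hf' : ¬ Function.Injective f := by simpa using hf
    simp only [Function.Injective, not_forall] at hf'
    obtain ⟨i, j, hij, hne⟩ := hf'
    rw [Matrix.det_zero_of_row_eq hne, mul_zero]
    funext k
    simp [hij]
  -- An injective map is its image together with a permutation of the increasing enumeration of that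
  -- image.
  let g : (Σ _ : {σ : Finset (Fin N) // σ.card = n}, Equiv.Perm (Fin n)) → Fin n → Fin N :=
    fun x i => x.1.1.orderEmbOfFin x.1.2 (x.2 i)
  have hg : ∀ x, Function.Injective (g x) := fun x =>
    (x.1.1.orderEmbOfFin x.1.2).injective.comp x.2.injective
  have himage : ∀ x, Finset.univ.image (g x) = x.1.1 := by
    intro x
    have : g x = x.1.1.orderEmbOfFin x.1.2 ∘ x.2 := rfl
    rw [← Finset.coe_inj, Finset.coe_image, Finset.coe_univ, Set.image_univ, this,
      x.2.surjective.range_comp, Finset.range_orderEmbOfFin]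
  rw [h1]
  have h2 : ∑ f : Fin n → Fin N with Function.Injective f,
        (∏ i, P i (f i)) * (Q.submatrix f id).det =
      ∑ x : (Σ _ : {σ : Finset (Fin N) // σ.card = n}, Equiv.Perm (Fin n)),
        (∏ i, P i (g x i)) * (Q.submatrix (g x) id).det := by
    symm
    refine Finset.sum_bij (fun x _ => g x) (fun x _ => by simpa using hg x) ?_ ?_
      (fun _ _ => rfl)
    · rintro ⟨σ, π⟩ _ ⟨σ', π'⟩ _ hxy
      have hσ : σ = σ' := Subtype.ext (by rw [← himage ⟨σ, π⟩, hxy, himage])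
      subst hσ
      have hπ : π = π' := Equiv.ext fun i =>
        (σ.1.orderEmbOfFin σ.2).injective (congrFun hxy i)
      rw [hπ]
    · intro f hf
      have hf' : Function.Injective f := by simpa using hf
      have hcard : (Finset.univ.image f).card = n := by
        rw [Finset.card_image_of_injective _ hf', Finset.card_univ, Fintype.card_fin]
      let e := (Finset.univ.image f).orderIsoOfFin hcard
      let p : Fin n → Fin n := fun i => e.symm ⟨f i, Finset.mem_image_of_mem f (Finset.mem_univ i)⟩
      have hp : Function.Injective p := by
        intro i j hij
        exact hf' (congrArg Subtype.val (e.symm.injective hij))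
      refine ⟨⟨⟨_, hcard⟩, Equiv.ofBijective p (Finite.injective_iff_bijective.1 hp)⟩,
        Finset.mem_univ _, ?_⟩
      funext i
      change ((e (p i) : (Finset.univ.image f)) : Fin N) = f i
      rw [e.apply_symm_apply]
  rw [h2, ← Finset.univ_sigma_univ, Finset.sum_sigma]
  refine Finset.sum_congr rfl fun σ _ => ?_
  rw [Matrix.det_apply' (P.submatrix id _), Finset.sum_mul, ← Equiv.sum_comp (Equiv.inv _)]
  refine Finset.sum_congr rfl fun π _ => ?_
  have h3 : Q.submatrix (g ⟨σ, π⁻¹⟩) id =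
      (Q.submatrix (σ.1.orderEmbOfFin σ.2) id).submatrix (⇑π⁻¹) id := rfl
  change (∏ i, P i (g ⟨σ, π⁻¹⟩ i)) * (Q.submatrix (g ⟨σ, π⁻¹⟩) id).det = _
  rw [h3, Matrix.det_permute, Equiv.Perm.sign_inv, ← Equiv.prod_comp π]
  have h4 : ∀ i, P (π i) (g ⟨σ, π⁻¹⟩ (π i)) =
      P.submatrix id (σ.1.orderEmbOfFin σ.2) (π i) i := by
    intro i
    simp [g]
  rw [Finset.prod_congr rfl fun i _ => h4 i]
  ring

/-! ### Degeneration of the Horn–Kapranov map along the zeros of the cuspidal form -/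

section Cusps

variable {n N m : ℕ} {A : Matrix (Fin (n + 1)) (Fin N) ℤ} {B : Matrix (Fin N) (Fin m) ℂ}

theorem eval_linForm {l t : Fin m → ℂ} : eval t (linForm l) = ∑ i, l i * t i := by
  simp [linForm]

/-- The matrix `A` without its top row. -/
def hatMatrix (A : Matrix (Fin (n + 1)) (Fin N) ℤ) : Matrix (Fin n) (Fin N) ℂ :=
  Matrix.of fun i k => (A i.succ k : ℂ)

/-- By Cauchy–Binet: the minors of the second factor are those of `Â` times the products of the
entries of `Bt`, whence the squared minors. -/
theorem eval_cuspidalForm (t : Fin m → ℂ) :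
    eval t (cuspidalForm A B) =
      (hatMatrix A * (Matrix.diagonal (B.mulVec t) * (hatMatrix A).transpose)).det := by
  rw [det_mul_eq_sum_minors, cuspidalForm, map_sum]
  refine Finset.sum_congr rfl fun σ _ => ?_
  have h1 : ((hatMatrix A).submatrix id (σ.1.orderEmbOfFin σ.2)).det = (hatMinor A σ : ℂ) := by
    rw [hatMinor, Int.cast_det]
    rfl
  have h2 : (Matrix.diagonal (B.mulVec t) * (hatMatrix A).transpose).submatrix
      (σ.1.orderEmbOfFin σ.2) id = Matrix.diagonal
        (fun i => B.mulVec t (σ.1.orderEmbOfFin σ.2 i)) *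
      ((hatMatrix A).submatrix id (σ.1.orderEmbOfFin σ.2)).transpose := by
    ext i j
    simp [Matrix.diagonal_mul]
  have h3 : ∏ i, B.mulVec t (σ.1.orderEmbOfFin σ.2 i) = ∏ k ∈ σ.1, B.mulVec t k := by
    rw [← Finset.prod_image (f := B.mulVec t) (g := σ.1.orderEmbOfFin σ.2)
      (fun _ _ _ _ h => (σ.1.orderEmbOfFin σ.2).injective h), Finset.image_orderEmbOfFin_univ]
  rw [h2, Matrix.det_mul, Matrix.det_diagonal, Matrix.det_transpose, h1, h3, map_mul, map_prod,
    eval_C]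
  simp only [eval_linForm]
  change _ * ∏ k ∈ σ.1, B.mulVec t k = _
  ring

theorem linearIndependent_rows (hA : IsAlgConfig A) {g : Fin (n + 1) → ℂ}
    (hg : ∀ k, ∑ i, g i * (A i k : ℂ) = 0) : g = 0 := by
  have h : LinearIndependent ℂ (A.map (Int.cast : ℤ → ℂ)).row := by
    rw [linearIndependent_iff_card_eq_finrank_span, Fintype.card_fin, Set.finrank,
      ← Matrix.rank_eq_finrank_span_row, hA.full_rank]
  rw [Fintype.linearIndependent_iff] at h
  refine funext (h g (funext fun k => ?_))
  simpa [Finset.sum_apply] using hg k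

theorem fderiv_hornKapranov (ω : Fin (n + 1) → ℂ) (t : Fin m → ℂ)
    (x : (Fin (n + 1) → ℂ) × (Fin m → ℂ)) (k : Fin N) :
    fderiv ℂ (hornKapranov A B) (ω, t) x k =
      expA A ω k * ((∑ i, x.1 i * (A i k : ℂ)) * B.mulVec t k + B.mulVec x.2 k) := by
  let p : Fin m → ((Fin (n + 1) → ℂ) × (Fin m → ℂ)) →L[ℂ] ℂ := fun j =>
    (ContinuousLinearMap.proj j).comp (ContinuousLinearMap.snd ℂ (Fin (n + 1) → ℂ) (Fin m → ℂ))
  have hlin : ∀ k, HasFDerivAt (fun x : (Fin (n + 1) → ℂ) × (Fin m → ℂ) => B.mulVec x.2 k)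
      (∑ j, B k j • p j) (ω, t) := by
    intro k
    have h : HasFDerivAt (fun x => ∑ j, B k j * p j x) (∑ j, B k j • p j) (ω, t) :=
      HasFDerivAt.fun_sum fun j _ => (p j).hasFDerivAt.const_mul _
    exact h
  have hexp : ∀ k, HasFDerivAt (fun x : (Fin (n + 1) → ℂ) × (Fin m → ℂ) => expA A x.1 k)
      ((expA A ω k • ∑ i, (A i k : ℂ) •
        (ContinuousLinearMap.proj i : (Fin (n + 1) → ℂ) →L[ℂ] ℂ)).comp
          (ContinuousLinearMap.fst ℂ (Fin (n + 1) → ℂ) (Fin m → ℂ))) (ω, t) := fun k =>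
    HasFDerivAt.comp (g := fun ω => expA A ω k) (ω, t) (hasFDerivAt_expA A ω k)
      (ContinuousLinearMap.fst ℂ (Fin (n + 1) → ℂ) (Fin m → ℂ)).hasFDerivAt
  have hall : HasFDerivAt (hornKapranov A B) (ContinuousLinearMap.pi fun k => _) (ω, t) :=
    hasFDerivAt_pi.2 fun k => (hexp k).mul (hlin k)
  rw [hall.fderiv]
  have hB : ∀ z : Fin m → ℂ, B.mulVec z k = ∑ j, B k j * z j := fun z => rfl
  simp [hB, p, mul_comm (x.1 _)]
  ring

/-- Let `v` be a kernel vector of `Â diag(Bt) Âᵀ`. After dividing by `e^⟨ω, αₖ⟩`, the image of the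
differential is orthogonal to the all-ones vector and to `Âᵀ v`. These two are independent since `A`
has full rank, so the image has codimension at least two. -/
theorem finrank_range_fderiv_le (hA : IsAlgConfig A) (hB : IsGaleDual A B)
    {ω : Fin (n + 1) → ℂ} {t : Fin m → ℂ} (ht : eval t (cuspidalForm A B) = 0) :
    Module.finrank ℂ (LinearMap.range (fderiv ℂ (hornKapranov A B) (ω, t)).toLinearMap) + 2 ≤
      N := by
  have hAB : ∀ (t : Fin m → ℂ) i, ∑ k, (A i k : ℂ) * B.mulVec t k = 0 := fun t i =>
    congrFun ((hB.exact (B.mulVec t)).2 ⟨t, rfl⟩) i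
  rw [eval_cuspidalForm] at ht
  obtain ⟨v, hv0, hv⟩ := Matrix.exists_mulVec_eq_zero_iff.2 ht
  have hv' : ∀ i : Fin n, ∑ k, (A i.succ k : ℂ) *
      (B.mulVec t k * ∑ j, (A j.succ k : ℂ) * v j) = 0 := by
    intro i
    have := congrFun hv i
    rw [← Matrix.mulVec_mulVec, ← Matrix.mulVec_mulVec] at this
    refine Eq.trans (Finset.sum_congr rfl fun k _ => ?_) this
    rw [Matrix.mulVec_diagonal]
    rfl
  let y : Fin 2 → Fin N → ℂ := ![fun k => (expA A ω k)⁻¹,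
    fun k => (expA A ω k)⁻¹ * ∑ j, (A j.succ k : ℂ) * v j]
  have hexp : ∀ k, expA A ω k ≠ 0 := fun k => Complex.exp_ne_zero _
  have hy : LinearIndependent ℂ y := by
    rw [LinearIndependent.pair_iff]
    intro a b hab
    have h1 : (Fin.cons a (b • v) : Fin (n + 1) → ℂ) = 0 := by
      apply linearIndependent_rows hA
      intro k
      have := congrFun hab k
      simp only [Pi.add_apply, Pi.smul_apply, smul_eq_mul, Pi.zero_apply] at this
      rw [Fin.sum_univ_succ, hA.top_row]
      simp only [Fin.cons_zero, Fin.cons_succ, Int.cast_one, mul_one, Pi.smul_apply, smul_eq_mul]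
      have h2 : a + b * ∑ j, (A j.succ k : ℂ) * v j = 0 := by
        have h3 := congrArg (expA A ω k * ·) this
        simp only [mul_zero] at h3
        have := hexp k
        field_simp at h3
        exact h3
      rw [← h2, Finset.mul_sum]
      congr 1
      exact Finset.sum_congr rfl fun j _ => by ring
    have ha : a = 0 := congrFun h1 0
    refine ⟨ha, ?_⟩
    have hb : b • v = 0 := funext fun j => congrFun h1 j.succ
    exact (smul_eq_zero.1 hb).resolve_right hv0
  have hle : LinearMap.range (fderiv ℂ (hornKapranov A B) (ω, t)).toLinearMap ≤
      orth (Submodule.span ℂ (Set.range y)) := by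
    rintro _ ⟨x, rfl⟩
    have hspan : Submodule.span ℂ (Set.range y) ≤ orth (Submodule.span ℂ
        {(fderiv ℂ (hornKapranov A B) (ω, t)).toLinearMap x}) := by
      apply Submodule.span_le.2
      rintro _ ⟨i, rfl⟩ z hz
      obtain ⟨a, rfl⟩ := Submodule.mem_span_singleton.1 hz
      have key : ∑ k, fderiv ℂ (hornKapranov A B) (ω, t) x k * y i k = 0 := by
        have hA0 : ∀ k, (A 0 k : ℂ) = 1 := fun k => by rw [hA.top_row, Int.cast_one]
        have hcomb : ∀ (q : Fin (n + 1) → ℂ) (z : Fin N → ℂ),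
            (∀ i, ∑ k, (A i k : ℂ) * z k = 0) → ∑ k, (∑ i, q i * (A i k : ℂ)) * z k = 0 := by
          intro q z hz
          simp only [Finset.sum_mul, mul_assoc]
          rw [Finset.sum_comm]
          simp only [← Finset.mul_sum, hz, mul_zero, Finset.sum_const_zero]
        have hcomb' : ∀ z : Fin N → ℂ, (∀ i, ∑ k, (A i k : ℂ) * z k = 0) →
            ∑ k, z k * ∑ j, (A j.succ k : ℂ) * v j = 0 := by
          intro z hz
          rw [← hcomb (Fin.cons 0 v) z hz]
          refine Finset.sum_congr rfl fun k _ => ?_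
          rw [Fin.sum_univ_succ]
          simp only [Fin.cons_zero, Fin.cons_succ, zero_mul, zero_add, mul_comm (v _)]
          ring
        fin_cases i
        · have h1 := hcomb x.1 _ (hAB t)
          have h2 := hAB x.2 0
          simp only [hA0, one_mul] at h2
          refine (Finset.sum_congr rfl fun k _ => ?_).trans (Finset.sum_add_distrib.trans
            ((congrArg₂ (· + ·) h1 h2).trans (add_zero 0)))
          change fderiv ℂ (hornKapranov A B) (ω, t) x k * (expA A ω k)⁻¹ = _
          rw [fderiv_hornKapranov]
          have := hexp k
          field_simp
        · have h1 := hcomb x.1 (fun k => B.mulVec t k * ∑ j, (A j.succ k : ℂ) * v j) fun i => by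
            induction i using Fin.cases with
            | zero =>
              simp only [hA0, one_mul]
              exact hcomb' _ (hAB t)
            | succ i => exact hv' i
          have h2 := hcomb' _ (hAB x.2)
          refine (Finset.sum_congr rfl fun k _ => ?_).trans (Finset.sum_add_distrib.trans
            ((congrArg₂ (· + ·) h1 h2).trans (add_zero 0)))
          change fderiv ℂ (hornKapranov A B) (ω, t) x k *
            ((expA A ω k)⁻¹ * ∑ j, (A j.succ k : ℂ) * v j) = _
          rw [fderiv_hornKapranov]
          have := hexp k
          field_simp
      have : ∀ k, (a • (fderiv ℂ (hornKapranov A B) (ω, t)).toLinearMap x) k * y i k =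
          a * (fderiv ℂ (hornKapranov A B) (ω, t) x k * y i k) := fun k => mul_assoc _ _ _
      rw [Finset.sum_congr rfl fun k _ => this k, ← Finset.mul_sum, key, mul_zero]
    intro e he
    have := hspan he _ (Submodule.mem_span_singleton_self _)
    rw [← this]
    exact Finset.sum_congr rfl fun k _ => mul_comm _ _
  have h1 := Submodule.finrank_mono hle
  have h2 := finrank_orth_add (Submodule.span ℂ (Set.range y))
  rw [finrank_span_eq_card hy, Fintype.card_fin] at h2
  omega

end Cusps

end Cuspidal

end

noncomputable section

namespace Cuspidal

/-! ### The image of a hyperplane -/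

section Hyperplane

variable {n N m : ℕ} {A : Matrix (Fin (n + 1)) (Fin N) ℤ} {B : Matrix (Fin N) (Fin m) ℂ}
  {l : Fin m → ℂ}

theorem torusClosure_mono {N : ℕ} {S T : Set (Fin N → ℂ)} (h : S ⊆ T) :
    torusClosure S ⊆ torusClosure T :=
  Set.inter_subset_inter_right _ (zeroLocus_anti_mono (vanishingIdeal_anti_mono h))

theorem finrank_rowSpan (hA : IsAlgConfig A) : Module.finrank ℂ (rowSpan A) = n + 1 := by
  refine Eq.trans ?_ hA.full_rank
  rw [Matrix.rank_eq_finrank_span_row]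
  rfl

theorem mem_orth_rowSpan_iff {c : Fin N → ℂ} :
    c ∈ orth (rowSpan A) ↔ (A.map (Int.cast : ℤ → ℂ)).mulVec c = 0 := by
  constructor
  · intro h
    exact funext fun i => h _ (Submodule.subset_span ⟨i, rfl⟩)
  · intro h e he
    induction he using Submodule.span_induction with
    | mem e he =>
      obtain ⟨i, rfl⟩ := he
      exact congrFun h i
    | zero => simp
    | add e e' _ _ h1 h2 => simp [add_mul, Finset.sum_add_distrib, h1, h2]
    | smul a e _ h1 => simp [mul_assoc, ← Finset.mul_sum, h1]

theorem orth_rowSpan (hB : IsGaleDual A B) : orth (rowSpan A) = LinearMap.range B.mulVecLin := by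
  ext c
  rw [mem_orth_rowSpan_iff, hB.exact]
  rfl

/-- The image under `B` of the hyperplane `⟨l, t⟩ = 0`. -/
def hyperplaneSpace (B : Matrix (Fin N) (Fin m) ℂ) (l : Fin m → ℂ) : Submodule ℂ (Fin N → ℂ) :=
  (orth (Submodule.span ℂ {l})).map B.mulVecLin

theorem mem_orth_span_singleton {t : Fin m → ℂ} :
    t ∈ orth (Submodule.span ℂ {l}) ↔ ∑ i, l i * t i = 0 := by
  constructor
  · intro h
    exact h l (Submodule.mem_span_singleton_self l)
  · intro h e he
    obtain ⟨a, rfl⟩ := Submodule.mem_span_singleton.1 he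
    simp [mul_assoc, ← Finset.mul_sum, h]

theorem rowSpan_le_orth_hyperplaneSpace (hB : IsGaleDual A B) :
    rowSpan A ≤ orth (hyperplaneSpace B l) := by
  rw [← orth_orth (rowSpan A), orth_rowSpan hB]
  exact orth_le_orth LinearMap.map_le_range

theorem finrank_orth_hyperplaneSpace (hA : IsAlgConfig A) (hB : IsGaleDual A B) (hl : l ≠ 0) :
    Module.finrank ℂ (orth (hyperplaneSpace B l)) = n + 2 := by
  have h1 : Module.finrank ℂ (hyperplaneSpace B l) =
      Module.finrank ℂ (orth (Submodule.span ℂ {l})) :=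
    (Submodule.equivMapOfInjective B.mulVecLin hB.injective _).finrank_eq.symm
  have h2 := finrank_orth_add (Submodule.span ℂ {l})
  rw [finrank_span_singleton hl] at h2
  have h3 := finrank_orth_add (hyperplaneSpace B l)
  have h4 := finrank_orth_add (rowSpan A)
  rw [orth_rowSpan hB, LinearMap.finrank_range_of_inj hB.injective,
    Module.finrank_fintype_fun_eq_card, Fintype.card_fin, finrank_rowSpan hA] at h4
  omega

/-- A row of `B` vanishing on the hyperplane lies in the double orthogonal complement of the line of
`l`, that is, in the line itself. -/
theorem exists_mem_hyperplaneSpace_ne_zero {k : Fin N} (hrow : ¬ ∃ a : ℂ, B k = a • l) :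
    ∃ w ∈ hyperplaneSpace B l, w k ≠ 0 := by
  by_contra! h
  apply hrow
  have h1 : B k ∈ orth (orth (Submodule.span ℂ {l})) := by
    intro t ht
    rw [← h _ (Submodule.mem_map_of_mem ht)]
    exact Finset.sum_congr rfl fun i _ => mul_comm _ _
  rw [orth_orth] at h1
  obtain ⟨a, ha⟩ := Submodule.mem_span_singleton.1 h1
  exact ⟨a, ha.symm⟩

theorem one_mem_rowSpan (hA : IsAlgConfig A) : (fun _ => 1) ∈ rowSpan A :=
  Submodule.subset_span ⟨0, funext fun k => by simp [hA.top_row]⟩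

/-- The image of a hyperplane has a generic point of Horn–Kapranov type. -/
theorem exists_generic_hyperplaneImage (hA : IsAlgConfig A) (hB : IsGaleDual A B) (hl : l ≠ 0)
    (hrow : ∀ k, ¬ ∃ a : ℂ, B k = a • l) :
    ∃ (q : ℕ) (s : Fin (n + 1) → UniversalField (n + 1) q)
      (c : Fin N → UniversalField (n + 1) q),
      IsGenericHorn A (hyperplaneSpace B l) s c ∧
        hyperplaneImage A B l = genericLocus (hornPoint A s c) := by
  have hL := fun k => exists_mem_hyperplaneSpace_ne_zero (hrow k)
  let v := Module.finBasis ℂ (hyperplaneSpace B l)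
  refine ⟨_, _, _, exists_isGenericHorn (A := A) v hL (rowSpan_le_orth_hyperplaneSpace hB)
    (one_mem_rowSpan hA) (finrank_rowSpan hA) (finrank_orth_hyperplaneSpace hA hB hl),
    torusClosure_eq_genericLocus (vanishingIdeal_hornImage A v hL fun f => ?_)⟩
  constructor
  · rintro ⟨ω, t, ht, hlt, rfl⟩
    exact ⟨ω, _, Submodule.mem_map_of_mem (mem_orth_span_singleton.2 hlt), ht, fun k => rfl⟩
  · rintro ⟨ω, _, ⟨t, ht, rfl⟩, hw, hf⟩
    exact ⟨ω, t, hw, mem_orth_span_singleton.1 ht, funext hf⟩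

theorem hyperplaneImage_subset_cuspidalLocus (hA : IsAlgConfig A) (hB : IsGaleDual A B)
    (hdvd : linForm l ∣ cuspidalForm A B) : hyperplaneImage A B l ⊆ cuspidalLocus A B := by
  apply torusClosure_mono
  rintro f ⟨ω, t, ht, hlt, rfl⟩
  obtain ⟨p, hp⟩ := hdvd
  exact ⟨ω, t, ht, finrank_range_fderiv_le hA hB
    (by rw [hp, map_mul, eval_linForm, hlt, zero_mul]), rfl⟩

end Hyperplane

end Cuspidal

end

theorem mainTheorem9 {n N m : ℕ} (A : Matrix (Fin (n + 1)) (Fin N) ℤ)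
    (hA : Cuspidal.IsAlgConfig A) (B : Matrix (Fin N) (Fin m) ℂ)
    (hB : Cuspidal.IsGaleDual A B) (l : Fin m → ℂ) (hl : l ≠ 0)
    (hdvd : Cuspidal.linForm l ∣ Cuspidal.cuspidalForm A B)
    (hrow : ∀ k, ¬ ∃ a : ℂ, B k = a • l) :
    Cuspidal.IsTorusSubvariety (Cuspidal.hyperplaneImage A B l) ∧
    Cuspidal.hyperplaneImage A B l ⊆ Cuspidal.cuspidalLocus A B ∧
    ∃ (n' N' : ℕ) (E : Matrix (Fin (n' + 1)) (Fin N') ℤ),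
      Cuspidal.IsAlgConfig E ∧
      Cuspidal.IsTorusSubvariety (Cuspidal.discriminant E) ∧
      Cuspidal.AreBirational (Cuspidal.discriminant E) (Cuspidal.hyperplaneImage A B l) := by
  obtain ⟨q, s, c, h, himage⟩ := Cuspidal.exists_generic_hyperplaneImage hA hB hl hrow
  obtain ⟨d, y, hy, hadjoin⟩ := h.exists_purely_transcendental
  -- The star configuration is built on the same `d + 1` generators, so both generic points generate
  -- the same subfield of one ambient field.
  obtain ⟨η, hη0, hdisc, hη⟩ := Cuspidal.exists_generic_discriminant_starConfig hy
  have hfield := hη.trans hadjoin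
  refine ⟨?_, Cuspidal.hyperplaneImage_subset_cuspidalLocus hA hB hdvd, d, d + 2,
    Cuspidal.starConfig d, Cuspidal.isAlgConfig_starConfig d, ?_, ?_⟩
  · rw [himage]
    exact Cuspidal.isTorusSubvariety_genericLocus h.hornPoint_ne_zero
  · rw [hdisc]
    exact Cuspidal.isTorusSubvariety_genericLocus hη0
  · rw [hdisc, himage]
    refine Cuspidal.areBirational_genericLocus hη0 h.hornPoint_ne_zero (fun j => ?_) fun i => ?_
    · rw [hfield]
      exact IntermediateField.subset_adjoin ℂ _ ⟨j, rfl⟩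
    · have := IntermediateField.subset_adjoin ℂ _ (Set.mem_range_self (f := η) i)
      rw [hfield] at this
      exact this
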